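/- Let $k$ be an algebraically closed field, let $t,n$ be integers with $4\le 2t\le n$, and put $V=k^n$, $E=k^{2t-2}$. Let $\langle\ ,\ \rangle$ be the alternating bilinear form on $E$ whose Gram matrix in the standard basis is $\tilde J=\begin{pmatrix}0&J\\-J&0\end{pmatrix}$, where $J$ is the $(t-1)\times(t-1)$ matrix with ones on the antidiagonal and zeros elsewhere. Let $G=\{g : {}^tg\tilde Jg=\tilde J\}$ be the symplectic group scheme of $E$, acting on the affine space $M=\operatorname{Hom}(V,E)$ by $(g,\varphi)\mapsto g\varphi$. For $s\ge 1$ let $Y_s$ be the closed subscheme of the affine space of alternating $n\times n$ matrices defined by the vanishing of the Pfaffians of all main $2s\times 2s$ submatrices (same row and column indices $i_1<\dots<i_{2s}$). Let $\pi\colon M\to Y_t$ be the $k$-morphism $X\mapsto {}^tX\tilde JX$, where $X$ is the matrix of $\varphi\in M$ (that is, $\varphi\in M$ is sent to the pulled back form $\langle\varphi\,\cdot,\varphi\,\cdot\rangle$), and let $U=Y_t\setminus Y_{t-1}$, an open subscheme of $Y_t$. Then the underlying set of $U$ is the locus of alternating matrices of rank exactly $2(t-1)$ (the rank at a point being taken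 over its residue field), and the restriction $\pi|_{\pi^{-1}(U)}\colon \pi^{-1}(U)\to U$ is a principal $G$-bundle, i.e. 1. it is faithfully flat (flat and surjective); 2. it is $G$-invariant: $\pi(gx)=\pi(x)$, as an equality of morphisms $G\times\pi^{-1}(U)\to U$, where $G$ acts on $\pi^{-1}(U)$ by restriction of its action on $M$; 3. the morphism $\Phi\colon G\times\pi^{-1}(U)\to\pi^{-1}(U)\times_U\pi^{-1}(U)$, $\Phi(g,x)=(gx,x)$, is an isomorphism of schemes. -/

import Mathlib

open Matrix
noncomputable section
namespace SymplecticInvariants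
universe u

/-- The odd positions `1, 3, …, 2m-1`, which are `0, 2, …, 2m-2` when counted from `0`. -/
def evenIdx {m : ℕ} (i : Fin m) : Fin (2 * m) := ⟨2 * i, by omega⟩
/-- The even positions `2, 4, …, 2m`, which are `1, 3, …, 2m-1` when counted from `0`. -/
def oddIdx {m : ℕ} (i : Fin m) : Fin (2 * m) := ⟨2 * i + 1, by omega⟩

/-- The permutations `σ` of `2m` letters with `σ 1 < σ 3 < ⋯` and `σ (2i-1) < σ (2i)` for all `i`
(the letters are numbered from `0` here). -/
def IsPfaffianPerm {m : ℕ} (σ : Equiv.Perm (Fin (2 * m))) : Prop :=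
  StrictMono (fun i : Fin m => σ (evenIdx i)) ∧ ∀ i : Fin m, σ (evenIdx i) < σ (oddIdx i)

open Classical in
/-- The Pfaffian of a `2m × 2m` matrix. -/
def pfaffian {R : Type*} [CommRing R] {m : ℕ}
    (A : Matrix (Fin (2 * m)) (Fin (2 * m)) R) : R :=
  ∑ σ : Equiv.Perm (Fin (2 * m)) with IsPfaffianPerm σ,
    ((Equiv.Perm.sign σ : ℤ) : R) * ∏ i : Fin m, A (σ (evenIdx i)) (σ (oddIdx i))

theorem map_pfaffian {R S : Type*} [CommRing R] [CommRing S] (f : R →+* S) {m : ℕ}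
    (A : Matrix (Fin (2 * m)) (Fin (2 * m)) R) : f (pfaffian A) = pfaffian (A.map f) := by
  simp [pfaffian, map_sum, map_prod]

/-- Positions, as a pair number together with a place in the pair. -/
def pairIdx (m : ℕ) : Fin m × Bool ≃ Fin (2 * m) where
  toFun p := bif p.2 then oddIdx p.1 else evenIdx p.1
  invFun j := (⟨j / 2, by omega⟩, decide (j.1 % 2 = 1))
  left_inv := by
    rintro ⟨i, b⟩
    cases b
    · simp [evenIdx]
    · simp [oddIdx, Fin.ext_iff]
      omega
  right_inv j := by
    rcases Nat.mod_two_eq_zero_or_one j.1 with h | h <;>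
      simp [oddIdx, evenIdx, Fin.ext_iff, h] <;> omega

@[simp] theorem pairIdx_true {m : ℕ} (i : Fin m) : pairIdx m (i, true) = oddIdx i := rfl
@[simp] theorem pairIdx_false {m : ℕ} (i : Fin m) : pairIdx m (i, false) = evenIdx i := rfl

/-- Permuting the pairs by `τ` and flipping the pairs marked by `ε`. -/
def pairPerm {m : ℕ} (τ : Equiv.Perm (Fin m)) (ε : Fin m → Bool) : Equiv.Perm (Fin (2 * m)) :=
  (pairIdx m).permCongr
    ((Equiv.prodCongrRight fun i => if ε i then Equiv.boolNot else 1).trans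
      (τ.prodCongr (Equiv.refl Bool)))

theorem pairPerm_even {m : ℕ} (τ : Equiv.Perm (Fin m)) (ε : Fin m → Bool) (i : Fin m) :
    pairPerm τ ε (evenIdx i) = pairIdx m (τ i, ε i) := by
  rw [← pairIdx_false]
  simp only [pairPerm, Equiv.permCongr_apply, Equiv.symm_apply_apply]
  cases h : ε i <;> simp [h]

theorem pairPerm_odd {m : ℕ} (τ : Equiv.Perm (Fin m)) (ε : Fin m → Bool) (i : Fin m) :
    pairPerm τ ε (oddIdx i) = pairIdx m (τ i, !ε i) := by
  rw [← pairIdx_true]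
  simp only [pairPerm, Equiv.permCongr_apply, Equiv.symm_apply_apply]
  cases h : ε i <;> simp [h]

theorem sign_pairPerm {m : ℕ} (τ : Equiv.Perm (Fin m)) (ε : Fin m → Bool) :
    Equiv.Perm.sign (pairPerm τ ε) = ∏ i, (if ε i then -1 else 1) := by
  rw [pairPerm, Equiv.Perm.sign_permCongr]
  rw [← Equiv.Perm.mul_def, Equiv.Perm.sign_mul]
  have h1 : Equiv.Perm.sign (τ.prodCongr (Equiv.refl Bool)) = 1 := by
    have : τ.prodCongr (Equiv.refl Bool) = Equiv.prodCongrLeft (fun _ : Bool => τ) := by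
      ext ⟨_, _⟩ <;> simp
    rw [this, Equiv.Perm.sign_prodCongrLeft]
    simp
  rw [h1, one_mul, Equiv.Perm.sign_prodCongrRight]
  refine Finset.prod_congr rfl fun i _ => ?_
  split_ifs
  · decide
  · simp


theorem existsUnique_pairPerm {m : ℕ} (σ : Equiv.Perm (Fin (2 * m))) :
    ∃! p : Equiv.Perm (Fin m) × (Fin m → Bool), IsPfaffianPerm (σ * pairPerm p.1 p.2) := by
  classical
  let s : Fin m → Bool := fun i => decide (σ (oddIdx i) < σ (evenIdx i))
  let f : Fin m → Fin (2 * m) := fun i => σ (pairIdx m (i, s i))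
  have hf : Function.Injective f := fun i j h => by
    have := (pairIdx m).injective (σ.injective h)
    exact congrArg Prod.fst this
  have hne : ∀ i : Fin m, σ (evenIdx i) ≠ σ (oddIdx i) := fun i h => by
    have := σ.injective h
    simp [evenIdx, oddIdx] at this
  have key : ∀ (τ : Equiv.Perm (Fin m)) (ε : Fin m → Bool),
      IsPfaffianPerm (σ * pairPerm τ ε) ↔ StrictMono (f ∘ τ) ∧ ε = s ∘ τ := by
    intro τ ε
    have h2 : (∀ i : Fin m, (σ * pairPerm τ ε) (evenIdx i) < (σ * pairPerm τ ε) (oddIdx i)) ↔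
        ε = s ∘ τ := by
      rw [funext_iff]
      refine forall_congr' fun i => ?_
      simp only [Equiv.Perm.mul_apply, pairPerm_even, pairPerm_odd, Function.comp_apply, s]
      have := hne (τ i)
      cases ε i
      · simp only [pairIdx_false, Bool.not_false, pairIdx_true]
        constructor
        · intro h; simpa using h.le
        · intro h; exact lt_of_le_of_ne (by simpa using h.symm) this
      · simp only [pairIdx_true, Bool.not_true, pairIdx_false]
        constructor
        · intro h; simpa using h
        · intro h; simpa using h.symm
    rw [IsPfaffianPerm, h2]
    refine and_congr_left fun h => ?_
    subst h
    have : (fun i => (σ * pairPerm τ (s ∘ τ)) (evenIdx i)) = f ∘ τ := by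
      funext i
      simp [pairPerm_even, f]
    rw [this]
  refine ⟨(Tuple.sort f, s ∘ Tuple.sort f), ?_, ?_⟩
  · exact (key _ _).2 ⟨(Tuple.monotone_sort f).strictMono_of_injective
      (hf.comp (Tuple.sort f).injective), rfl⟩
  · rintro ⟨τ, ε⟩ h
    obtain ⟨h1, h2⟩ := (key _ _).1 h
    have : τ = Tuple.sort f := by
      have := Tuple.unique_monotone h1.monotone (Tuple.monotone_sort f)
      ext i
      exact congrArg Fin.val (hf (congrFun this i))
    subst this
    simp at h2
    simp [h2]

/-- The summand of the Pfaffian. -/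
def pfaffianTerm {R : Type*} [CommRing R] {m : ℕ} (A : Matrix (Fin (2 * m)) (Fin (2 * m)) R)
    (σ : Equiv.Perm (Fin (2 * m))) : R :=
  ((Equiv.Perm.sign σ : ℤ) : R) * ∏ i : Fin m, A (σ (evenIdx i)) (σ (oddIdx i))

theorem pfaffianTerm_mul {R : Type*} [CommRing R] {m : ℕ}
    (A : Matrix (Fin (2 * m)) (Fin (2 * m)) R) (hA : ∀ i j, A i j = -A j i)
    (σ : Equiv.Perm (Fin (2 * m))) (τ : Equiv.Perm (Fin m)) (ε : Fin m → Bool) :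
    pfaffianTerm A (σ * pairPerm τ ε) = pfaffianTerm A σ := by
  have h : ∀ i : Fin m, A ((σ * pairPerm τ ε) (evenIdx i)) ((σ * pairPerm τ ε) (oddIdx i)) =
      (if ε i then -1 else 1) * A (σ (evenIdx (τ i))) (σ (oddIdx (τ i))) := by
    intro i
    simp only [Equiv.Perm.mul_apply, pairPerm_even, pairPerm_odd]
    cases ε i
    · simp
    · simp [hA (σ (oddIdx (τ i)))]
  have h3 : (∏ i, (if ε i then (-1 : R) else 1)) * ∏ i, (if ε i then (-1 : R) else 1) = 1 := by
    rw [← Finset.prod_mul_distrib]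
    refine Finset.prod_eq_one fun i _ => ?_
    split_ifs <;> simp
  have h4 : (((∏ i, (if ε i then (-1 : ℤˣ) else 1) : ℤˣ) : ℤ) : R) =
      ∏ i, (if ε i then (-1 : R) else 1) := by
    rw [Units.coe_prod, Int.cast_prod]
    refine Finset.prod_congr rfl fun i _ => ?_
    split_ifs <;> simp
  have h5 : ∏ i, A (σ (evenIdx (τ i))) (σ (oddIdx (τ i))) =
      ∏ i, A (σ (evenIdx i)) (σ (oddIdx i)) :=
    Equiv.prod_comp τ fun i => A (σ (evenIdx i)) (σ (oddIdx i))
  simp only [pfaffianTerm, h, Finset.prod_mul_distrib, Equiv.Perm.sign_mul, sign_pairPerm,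
    Units.val_mul, Int.cast_mul, h4, h5]
  linear_combination (((Equiv.Perm.sign σ : ℤ) : R) * ∏ i, A (σ (evenIdx i)) (σ (oddIdx i))) * h3

theorem sum_pfaffianTerm {R : Type*} [CommRing R] {m : ℕ}
    (A : Matrix (Fin (2 * m)) (Fin (2 * m)) R) (hA : ∀ i j, A i j = -A j i) :
    ∑ σ, pfaffianTerm A σ =
      (Fintype.card (Equiv.Perm (Fin m) × (Fin m → Bool)) : R) * pfaffian A := by
  classical
  have h1 : ∀ σ, pfaffianTerm A σ = ∑ p : Equiv.Perm (Fin m) × (Fin m → Bool),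
      if IsPfaffianPerm (σ * pairPerm p.1 p.2) then pfaffianTerm A (σ * pairPerm p.1 p.2)
      else 0 := by
    intro σ
    obtain ⟨p, hp, hu⟩ := existsUnique_pairPerm σ
    rw [Finset.sum_eq_single p, if_pos hp, pfaffianTerm_mul A hA]
    · intro q _ hq
      exact if_neg fun h => hq (hu q h)
    · simp
  have h2 : ∀ p : Equiv.Perm (Fin m) × (Fin m → Bool),
      (∑ σ, if IsPfaffianPerm (σ * pairPerm p.1 p.2) then pfaffianTerm A (σ * pairPerm p.1 p.2)
      else 0) = pfaffian A := by
    intro p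
    refine (Equiv.sum_comp (Equiv.mulRight (pairPerm p.1 p.2))
      (fun σ => if IsPfaffianPerm σ then pfaffianTerm A σ else 0)).trans ?_
    rw [← Finset.sum_filter]
    simp [pfaffian, pfaffianTerm]
  rw [Finset.sum_congr rfl fun σ _ => h1 σ, Finset.sum_comm, Finset.sum_congr rfl fun p _ => h2 p]
  simp

theorem sum_pfaffianTerm_conj {R ι : Type*} [CommRing R] [Fintype ι] [DecidableEq ι] {m : ℕ}
    (hm : Fintype.card ι < 2 * m) (J : Matrix ι ι R) (X : Matrix ι (Fin (2 * m)) R) :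
    ∑ σ, pfaffianTerm (Xᵀ * J * X) σ = 0 := by
  have h1 : ∀ σ : Equiv.Perm (Fin (2 * m)), pfaffianTerm (Xᵀ * J * X) σ =
      ∑ g : Fin m → ι × ι, (∏ i, J (g i).1 (g i).2) * (((Equiv.Perm.sign σ : ℤ) : R) *
        ∏ a, X (bif ((pairIdx m).symm a).2 then (g ((pairIdx m).symm a).1).2
          else (g ((pairIdx m).symm a).1).1) (σ a)) := by
    intro σ
    have e : ∀ a b, (Xᵀ * J * X) a b = ∑ p : ι × ι, J p.1 p.2 * (X p.1 a * X p.2 b) := by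
      intro a b
      simp only [Matrix.mul_apply, Finset.sum_mul, Matrix.transpose_apply, Fintype.sum_prod_type]
      rw [Finset.sum_comm]
      refine Finset.sum_congr rfl fun p _ => Finset.sum_congr rfl fun q _ => by ring
    simp only [pfaffianTerm, e]
    rw [Fintype.prod_sum, Finset.mul_sum]
    refine Finset.sum_congr rfl fun g _ => ?_
    rw [← Equiv.prod_comp (pairIdx m), Fintype.prod_prod_type]
    simp only [Fintype.prod_bool, Equiv.symm_apply_apply, pairIdx_true, pairIdx_false, cond_true,
      cond_false, Finset.prod_mul_distrib]
    ring
  rw [Finset.sum_congr rfl fun σ _ => h1 σ, Finset.sum_comm]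
  refine Finset.sum_eq_zero fun g _ => ?_
  rw [← Finset.mul_sum]
  set f : Fin (2 * m) → ι := fun a => bif ((pairIdx m).symm a).2 then
    (g ((pairIdx m).symm a).1).2 else (g ((pairIdx m).symm a).1).1 with hf
  have h2 : ∑ σ : Equiv.Perm (Fin (2 * m)), ((Equiv.Perm.sign σ : ℤ) : R) * ∏ a, X (f a) (σ a) =
      (X.submatrix f id)ᵀ.det := by
    rw [Matrix.det_apply']
    rfl
  obtain ⟨a, b, hab, he⟩ := Fintype.exists_ne_map_eq_of_card_lt f (by simpa using hm)
  rw [h2, Matrix.det_transpose, Matrix.det_zero_of_row_eq hab, mul_zero]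
  funext c
  simp [he]

/-- A form of rank less than `2m` has vanishing Pfaffians of size `2m`. -/
theorem pfaffian_conj_eq_zero {R ι : Type*} [CommRing R] [Fintype ι] [DecidableEq ι] {m : ℕ}
    (hm : Fintype.card ι < 2 * m) (J : Matrix ι ι ℤ) (hJ : ∀ i j, J i j = -J j i)
    (X : Matrix ι (Fin (2 * m)) R) :
    pfaffian (Xᵀ * J.map (Int.cast : ℤ → R) * X) = 0 := by
  let S := MvPolynomial (ι × Fin (2 * m)) ℤ
  let Y : Matrix ι (Fin (2 * m)) S := fun i j => MvPolynomial.X (i, j)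
  have h0 : pfaffian (Yᵀ * J.map (Int.cast : ℤ → S) * Y) = 0 := by
    have hJ' : (J.map (Int.cast : ℤ → S))ᵀ = -J.map (Int.cast : ℤ → S) := by
      ext1 i j
      simp [hJ j i]
    have := sum_pfaffianTerm (Yᵀ * J.map (Int.cast : ℤ → S) * Y) (by
      intro i j
      rw [← Matrix.transpose_apply (Yᵀ * J.map (Int.cast : ℤ → S) * Y) i j,
        Matrix.transpose_mul, Matrix.transpose_mul, hJ', Matrix.transpose_transpose,
        Matrix.neg_mul, Matrix.mul_neg, Matrix.mul_assoc, Matrix.neg_apply, neg_neg])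
    rw [sum_pfaffianTerm_conj hm, eq_comm, mul_eq_zero] at this
    refine this.resolve_left ?_
    exact Nat.cast_ne_zero.2 Fintype.card_ne_zero
  let φ : S →+* R := MvPolynomial.eval₂Hom (Int.castRingHom R) fun p => X p.1 p.2
  have hY : Y.map φ = X := by
    ext i j
    exact MvPolynomial.eval₂_X _ _ _
  have hJ2 : (J.map (Int.cast : ℤ → S)).map φ = J.map (Int.cast : ℤ → R) := by
    ext i j
    simp
  have := congrArg φ h0
  rwa [map_pfaffian, Matrix.map_mul, Matrix.map_mul, Matrix.transpose_map, hY, hJ2,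
    map_zero] at this

/-- The `r × r` matrix with ones on the antidiagonal and zeros elsewhere. -/
def antidiagonalMatrix (r : ℕ) (R : Type*) [CommRing R] : Matrix (Fin r) (Fin r) R :=
  Matrix.of fun i j => if j = i.rev then 1 else 0

/-- The Gram matrix `J̃` of the symplectic form on `E = R^{2r}` in the standard basis, whose first
`r` vectors are indexed by the left and whose last `r` vectors by the right summand of
`Fin r ⊕ Fin r`. -/
def formMatrix (r : ℕ) (R : Type*) [CommRing R] : Matrix (Fin r ⊕ Fin r) (Fin r ⊕ Fin r) R :=
  Matrix.fromBlocks 0 (antidiagonalMatrix r R) (-antidiagonalMatrix r R) 0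

theorem antidiagonalMatrix_mul_self (r : ℕ) (R : Type*) [CommRing R] :
    antidiagonalMatrix r R * antidiagonalMatrix r R = 1 := by
  ext i j
  simp only [antidiagonalMatrix, Matrix.mul_apply, Matrix.of_apply, Matrix.one_apply, ite_mul,
    one_mul, zero_mul, Finset.sum_ite_eq', Finset.mem_univ, if_true, 
    Fin.rev_rev, eq_comm]

theorem formMatrix_mul_self (r : ℕ) (R : Type*) [CommRing R] :
    formMatrix r R * formMatrix r R = -1 := by
  simp [formMatrix, Matrix.fromBlocks_multiply, antidiagonalMatrix_mul_self,
    ← Matrix.fromBlocks_one, Matrix.fromBlocks_neg]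

theorem map_formMatrix (r : ℕ) {R S F : Type*} [CommRing R] [CommRing S] [FunLike F R S]
    [RingHomClass F R S] (f : F) : (formMatrix r R).map f = formMatrix r S := by
  ext (i | i) (j | j) <;> simp [formMatrix, antidiagonalMatrix, apply_ite f]

theorem formMatrix_apply_swap (r : ℕ) (R : Type*) [CommRing R] (i j : Fin r ⊕ Fin r) :
    formMatrix r R i j = -formMatrix r R j i := by
  have h : ∀ i j : Fin r, j = i.rev ↔ i = j.rev := fun i j => by rw [← Fin.rev_eq_iff, eq_comm]
  rcases i with i | i <;> rcases j with j | j <;> simp [formMatrix, antidiagonalMatrix, h i j]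

theorem formMatrix_transpose (r : ℕ) (R : Type*) [CommRing R] :
    (formMatrix r R)ᵀ = -formMatrix r R := by
  ext1 i j
  exact formMatrix_apply_swap r R j i

/-- The matrix of coordinate functions on the space of `m × n` matrices. -/
def genericMatrix (m n : Type) (R : Type u) [CommRing R] :
    Matrix m n (MvPolynomial (m × n) R) :=
  Matrix.of fun i j => MvPolynomial.X (i, j)

theorem map_genericMatrix_aeval {m n : Type} {R : Type u} [CommRing R] {B : Type*} [CommRing B]
    [Algebra R B] (g : Matrix m n B) :
    (genericMatrix m n R).map (MvPolynomial.aeval (R := R) fun p : m × n => g p.1 p.2) = g := by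
  ext i j
  simp [genericMatrix]

/-- The ideal of the equations `ᵗZ J̃ Z = J̃` of the symplectic group. -/
def symplecticIdeal (r : ℕ) (R : Type u) [CommRing R] :
    Ideal (MvPolynomial ((Fin r ⊕ Fin r) × (Fin r ⊕ Fin r)) R) :=
  Ideal.span (Set.range fun p : (Fin r ⊕ Fin r) × (Fin r ⊕ Fin r) =>
    ((genericMatrix (Fin r ⊕ Fin r) (Fin r ⊕ Fin r) R)ᵀ * (formMatrix r R).map MvPolynomial.C *
      genericMatrix (Fin r ⊕ Fin r) (Fin r ⊕ Fin r) R -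
        (formMatrix r R).map MvPolynomial.C : Matrix (Fin r ⊕ Fin r) (Fin r ⊕ Fin r)
          (MvPolynomial ((Fin r ⊕ Fin r) × (Fin r ⊕ Fin r)) R)) p.1 p.2)

/-- The coordinate ring of the symplectic group of `E = R^{2r}`. -/
def SymplecticRing (r : ℕ) (R : Type u) [CommRing R] : Type u :=
  MvPolynomial ((Fin r ⊕ Fin r) × (Fin r ⊕ Fin r)) R ⧸ symplecticIdeal r R

namespace SymplecticRing
variable (r : ℕ) (R : Type u) [CommRing R]

instance : CommRing (SymplecticRing r R) :=
  inferInstanceAs (CommRing (_ ⧸ symplecticIdeal r R))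

instance : Algebra R (SymplecticRing r R) :=
  inferInstanceAs (Algebra R (_ ⧸ symplecticIdeal r R))

/-- The quotient map. -/
def mk : MvPolynomial ((Fin r ⊕ Fin r) × (Fin r ⊕ Fin r)) R →ₐ[R] SymplecticRing r R :=
  Ideal.Quotient.mkₐ R (symplecticIdeal r R)

/-- The generic symplectic matrix. -/
def generic : Matrix (Fin r ⊕ Fin r) (Fin r ⊕ Fin r) (SymplecticRing r R) :=
  (genericMatrix _ _ R).map (mk r R)

theorem generic_rel : (generic r R)ᵀ * formMatrix r _ * generic r R = formMatrix r _ := by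
  rw [generic, ← map_formMatrix r (mk r R), ← Matrix.transpose_map,
    ← Matrix.map_mul, ← Matrix.map_mul]
  ext i j
  refine Ideal.Quotient.eq.2 (Ideal.subset_span ⟨(i, j), ?_⟩)
  simp only [map_formMatrix, Matrix.sub_apply]

variable {r R} {B : Type*} [CommRing B] [Algebra R B]

/-- The `B`-point of the symplectic group given by a matrix. -/
def lift (g : Matrix (Fin r ⊕ Fin r) (Fin r ⊕ Fin r) B)
    (hg : gᵀ * formMatrix r B * g = formMatrix r B) : SymplecticRing r R →ₐ[R] B :=
  Ideal.Quotient.liftₐ (symplecticIdeal r R) (MvPolynomial.aeval fun p => g p.1 p.2) (by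
    intro a ha
    have : symplecticIdeal r R ≤ RingHom.ker (MvPolynomial.aeval (R := R) fun p => g p.1 p.2) := by
      refine Ideal.span_le.2 ?_
      rintro _ ⟨⟨i, j⟩, rfl⟩
      set φ : MvPolynomial ((Fin r ⊕ Fin r) × (Fin r ⊕ Fin r)) R →ₐ[R] B :=
        MvPolynomial.aeval fun p => g p.1 p.2 with hφ
      have hZ : (genericMatrix _ _ R).map φ = g := map_genericMatrix_aeval g
      simp only [SetLike.mem_coe, RingHom.mem_ker, map_formMatrix, Matrix.sub_apply, map_sub]
      rw [← Matrix.map_apply (f := φ), ← Matrix.map_apply (f := φ), Matrix.map_mul, Matrix.map_mul,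
        Matrix.transpose_map, hZ,
        map_formMatrix, hg, sub_self]
    exact this ha)

theorem lift_generic (g : Matrix (Fin r ⊕ Fin r) (Fin r ⊕ Fin r) B)
    (hg : gᵀ * formMatrix r B * g = formMatrix r B) :
    (generic r R).map (lift (R := R) g hg) = g := by
  rw [generic]
  exact map_genericMatrix_aeval g

theorem algHom_ext {f g : SymplecticRing r R →ₐ[R] B}
    (h : (generic r R).map f = (generic r R).map g) : f = g := by
  refine Ideal.Quotient.algHom_ext _ (MvPolynomial.algHom_ext fun p => ?_)
  exact congrFun (congrFun h p.1) p.2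

theorem map_generic_rel (f : SymplecticRing r R →ₐ[R] B) :
    ((generic r R).map f)ᵀ * formMatrix r B * (generic r R).map f = formMatrix r B := by
  have := congrArg (fun M => M.map f) (generic_rel r R)
  simpa only [Matrix.map_mul, Matrix.transpose_map, map_formMatrix] using this

theorem rel_mul {g h : Matrix (Fin r ⊕ Fin r) (Fin r ⊕ Fin r) B}
    (hg : gᵀ * formMatrix r B * g = formMatrix r B)
    (hh : hᵀ * formMatrix r B * h = formMatrix r B) :
    (g * h)ᵀ * formMatrix r B * (g * h) = formMatrix r B := by
  calc (g * h)ᵀ * formMatrix r B * (g * h) = hᵀ * (gᵀ * formMatrix r B * g) * h := by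
        simp only [Matrix.transpose_mul, Matrix.mul_assoc]
    _ = _ := by rw [hg, hh]

theorem rel_inv_mul {g : Matrix (Fin r ⊕ Fin r) (Fin r ⊕ Fin r) B}
    (hg : gᵀ * formMatrix r B * g = formMatrix r B) :
    (-(formMatrix r B * gᵀ * formMatrix r B)) * g = 1 := by
  rw [Matrix.neg_mul, Matrix.mul_assoc, Matrix.mul_assoc, ← Matrix.mul_assoc gᵀ, hg,
    formMatrix_mul_self, neg_neg]

theorem rel_inv {g : Matrix (Fin r ⊕ Fin r) (Fin r ⊕ Fin r) B}
    (hg : gᵀ * formMatrix r B * g = formMatrix r B) :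
    (-(formMatrix r B * gᵀ * formMatrix r B))ᵀ * formMatrix r B *
      (-(formMatrix r B * gᵀ * formMatrix r B)) = formMatrix r B := by
  set h := -(formMatrix r B * gᵀ * formMatrix r B) with hh
  have h1 : h * g = 1 := rel_inv_mul hg
  have h2 : g * h = 1 := mul_eq_one_comm.1 h1
  have h3 : hᵀ * gᵀ = 1 := by rw [← Matrix.transpose_mul, h2, Matrix.transpose_one]
  calc hᵀ * formMatrix r B * h = hᵀ * (gᵀ * formMatrix r B * g) * h := by rw [hg]
    _ = (hᵀ * gᵀ) * formMatrix r B * (g * h) := by simp only [Matrix.mul_assoc]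
    _ = _ := by rw [h2, h3, Matrix.one_mul, Matrix.mul_one]

open scoped TensorProduct
open Algebra.TensorProduct (includeLeft includeRight)

theorem map_comp_matrix {m n A B C : Type*} [CommRing A] [CommRing B] [CommRing C] [Algebra R A]
    [Algebra R B] [Algebra R C] (M : Matrix m n A) (f : A →ₐ[R] B) (g : B →ₐ[R] C) :
    (M.map f).map g = M.map (g.comp f) := rfl

variable (r R)

/-- Comultiplication, dual to matrix multiplication. -/
def comul : SymplecticRing r R →ₐ[R] SymplecticRing r R ⊗[R] SymplecticRing r R :=
  lift ((generic r R).map (includeLeft (R := R) (S := R) (B := SymplecticRing r R)) *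
      (generic r R).map (includeRight (R := R) (A := SymplecticRing r R)))
    (rel_mul (map_generic_rel _) (map_generic_rel _))

/-- Counit, dual to the identity matrix. -/
def counit : SymplecticRing r R →ₐ[R] R :=
  lift 1 (by simp)

/-- Antipode, dual to matrix inversion. -/
def antipode : SymplecticRing r R →ₐ[R] SymplecticRing r R :=
  lift (-(formMatrix r _ * (generic r R)ᵀ * formMatrix r _)) (rel_inv (generic_rel r R))

theorem map_comul : (generic r R).map (comul r R) =
    (generic r R).map (includeLeft (R := R) (S := R) (B := SymplecticRing r R)) *
      (generic r R).map (includeRight (R := R) (A := SymplecticRing r R)) := lift_generic _ _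

theorem map_counit : (generic r R).map (counit r R) = 1 := lift_generic _ _

theorem map_antipode : (generic r R).map (antipode r R) =
    -(formMatrix r _ * (generic r R)ᵀ * formMatrix r _) := lift_generic _ _


instance : Bialgebra R (SymplecticRing r R) :=
  Bialgebra.ofAlgHom (comul r R) (counit r R)
    (by
      refine algHom_ext ?_
      simp only [← map_comp_matrix, map_comul, Matrix.map_mul]
      have h1 : (((generic r R).map (includeLeft (R := R) (S := R) (B := SymplecticRing r R))).map
          (Algebra.TensorProduct.map (comul r R) (.id R (SymplecticRing r R)))) =
          ((generic r R).map (comul r R)).map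
            (includeLeft (R := R) (S := R) (B := SymplecticRing r R)) := by
        ext i j; simp
      have h2 : (((generic r R).map (includeRight (R := R) (A := SymplecticRing r R))).map
          (Algebra.TensorProduct.map (.id R (SymplecticRing r R)) (comul r R))) =
          ((generic r R).map (comul r R)).map
            (includeRight (R := R) (A := SymplecticRing r R)) := by
        ext i j; simp
      rw [h1, h2, map_comul, Matrix.map_mul, Matrix.map_mul, Matrix.map_mul, Matrix.mul_assoc]
      refine congrArg₂ _ ?_ (congrArg₂ _ ?_ ?_)
      · ext i j; simp [Algebra.TensorProduct.one_def]
      · ext i j; simp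
      · ext i j; simp [Algebra.TensorProduct.one_def])
    (by
      refine algHom_ext ?_
      simp only [← map_comp_matrix, map_comul, Matrix.map_mul]
      have h1 : (((generic r R).map (includeLeft (R := R) (S := R) (B := SymplecticRing r R))).map
          (Algebra.TensorProduct.map (counit r R) (.id R (SymplecticRing r R)))) =
          ((generic r R).map (counit r R)).map
            (includeLeft (R := R) (S := R) (B := SymplecticRing r R)) := by
        ext i j; simp
      rw [h1, map_counit, Matrix.map_one _ (map_zero _) (map_one _), Matrix.one_mul]
      ext i j; simp)
    (by
      refine algHom_ext ?_
      simp only [← map_comp_matrix, map_comul, Matrix.map_mul]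
      have h1 : (((generic r R).map (includeRight (R := R) (A := SymplecticRing r R))).map
          (Algebra.TensorProduct.map (.id R (SymplecticRing r R)) (counit r R))) =
          ((generic r R).map (counit r R)).map
            (includeRight (R := R) (A := SymplecticRing r R)) := by
        ext i j; simp
      rw [h1, map_counit, Matrix.map_one _ (map_zero _) (map_one _), Matrix.mul_one]
      ext i j; simp)

instance : HopfAlgebra R (SymplecticRing r R) :=
  HopfAlgebra.ofAlgHom (antipode r R)
    (by
      refine algHom_ext ?_
      change (generic r R).map ((Algebra.TensorProduct.lift (antipode r R) (.id R _)
        fun _ _ ↦ Commute.all _ _).comp (comul r R)) =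
          (generic r R).map ((Algebra.ofId R _).comp (counit r R))
      simp only [← map_comp_matrix, map_comul, Matrix.map_mul, map_counit]
      have h1 : ((generic r R).map (includeLeft (R := R) (S := R) (B := SymplecticRing r R))).map
          (Algebra.TensorProduct.lift (antipode r R) (AlgHom.id R (SymplecticRing r R)) fun _ _ ↦
            Commute.all _ _) = (generic r R).map (antipode r R) := by
        ext i j; simp
      have h2 : ((generic r R).map (includeRight (R := R) (A := SymplecticRing r R))).map
          (Algebra.TensorProduct.lift (antipode r R) (AlgHom.id R (SymplecticRing r R)) fun _ _ ↦
            Commute.all _ _) = (generic r R).map (AlgHom.id R (SymplecticRing r R)) := by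
        ext i j; simp
      rw [h1, h2, map_antipode, Matrix.map_one _ (map_zero _) (map_one _)]
      exact rel_inv_mul (generic_rel r R))
    (by
      refine algHom_ext ?_
      change (generic r R).map ((Algebra.TensorProduct.lift (.id R _) (antipode r R)
        fun _ _ ↦ Commute.all _ _).comp (comul r R)) =
          (generic r R).map ((Algebra.ofId R _).comp (counit r R))
      simp only [← map_comp_matrix, map_comul, Matrix.map_mul, map_counit]
      have h1 : ((generic r R).map (includeLeft (R := R) (S := R) (B := SymplecticRing r R))).map
          (Algebra.TensorProduct.lift (AlgHom.id R (SymplecticRing r R)) (antipode r R) fun _ _ ↦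
            Commute.all _ _) = (generic r R).map (AlgHom.id R (SymplecticRing r R)) := by
        ext i j; simp
      have h2 : ((generic r R).map (includeRight (R := R) (A := SymplecticRing r R))).map
          (Algebra.TensorProduct.lift (AlgHom.id R (SymplecticRing r R)) (antipode r R) fun _ _ ↦
            Commute.all _ _) = (generic r R).map (antipode r R) := by
        ext i j; simp
      rw [h1, h2, map_antipode, Matrix.map_one _ (map_zero _) (map_one _)]
      exact mul_eq_one_comm.1 (rel_inv_mul (generic_rel r R)))

end SymplecticRing

/-! ### Coordinate rings -/

/-- The coordinate ring of `M = Hom(V, E)` with `V = R^n`, `E = R^{2r}`. -/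
abbrev HomRing (r n : ℕ) (R : Type u) [CommRing R] : Type u :=
  MvPolynomial ((Fin r ⊕ Fin r) × Fin n) R

/-- The coordinate ring of the affine space of alternating `n × n` matrices. -/
abbrev AltRing (n : ℕ) (R : Type u) [CommRing R] : Type u :=
  MvPolynomial {p : Fin n × Fin n // p.1 < p.2} R

/-- The alternating matrix whose entry above the diagonal at `(i, j)` is `a (i, j)`. -/
def alternatingMatrix {n : ℕ} {B : Type*} [CommRing B] (a : {p : Fin n × Fin n // p.1 < p.2} → B) :
    Matrix (Fin n) (Fin n) B :=
  Matrix.of fun i j =>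
    if h : i < j then a ⟨(i, j), h⟩ else if h : j < i then -a ⟨(j, i), h⟩ else 0

/-- The matrix of coordinate functions on the space of alternating `n × n` matrices. -/
def genericAlternating (n : ℕ) (R : Type u) [CommRing R] : Matrix (Fin n) (Fin n) (AltRing n R) :=
  alternatingMatrix MvPolynomial.X

/-- The ideal generated by the Pfaffians of the main `2s × 2s` submatrices. -/
def pfaffianIdeal (n s : ℕ) (R : Type u) [CommRing R] : Ideal (AltRing n R) :=
  Ideal.span (Set.range fun e : Fin (2 * s) ↪o Fin n =>
    pfaffian ((genericAlternating n R).submatrix e e))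

/-- The coordinate ring of the Pfaffian scheme `Y_s`. -/
def PfaffianRing (n s : ℕ) (R : Type u) [CommRing R] : Type u :=
  AltRing n R ⧸ pfaffianIdeal n s R

namespace PfaffianRing
variable (n s : ℕ) (R : Type u) [CommRing R]

instance : CommRing (PfaffianRing n s R) :=
  inferInstanceAs (CommRing (_ ⧸ pfaffianIdeal n s R))

instance : Algebra R (PfaffianRing n s R) :=
  inferInstanceAs (Algebra R (_ ⧸ pfaffianIdeal n s R))

/-- The restriction of functions from the space of alternating matrices to `Y_s`. -/
def mk : AltRing n R →ₐ[R] PfaffianRing n s R :=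
  Ideal.Quotient.mkₐ R (pfaffianIdeal n s R)

/-- The tautological alternating matrix on `Y_s`. -/
def generic : Matrix (Fin n) (Fin n) (PfaffianRing n s R) :=
  (genericAlternating n R).map (mk n s R)

end PfaffianRing

section comorphisms

open scoped TensorProduct
open Algebra.TensorProduct (includeLeft includeRight)

variable (r n : ℕ) (R : Type u) [CommRing R]

/-- The comorphism of the action `(g, φ) ↦ g φ` of the symplectic group on `Hom(V, E)`. -/
def coaction : HomRing r n R →ₐ[R] SymplecticRing r R ⊗[R] HomRing r n R :=
  MvPolynomial.aeval fun p =>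
    ((SymplecticRing.generic r R).map
        (includeLeft (R := R) (S := R) (B := HomRing r n R)) *
      (genericMatrix (Fin r ⊕ Fin r) (Fin n) R).map
        (includeRight (R := R) (A := SymplecticRing r R))) p.1 p.2

/-- The pulled back form `ᵗX J̃ X` for the generic `X`. -/
def pulledBackForm : Matrix (Fin n) (Fin n) (HomRing r n R) :=
  (genericMatrix (Fin r ⊕ Fin r) (Fin n) R)ᵀ * formMatrix r (HomRing r n R) *
    genericMatrix (Fin r ⊕ Fin r) (Fin n) R

/-- The comorphism of `φ ↦ ρ ∘ ⋀²φ`, as a map from `Hom(V, E)` to all alternating matrices. -/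
def coquotientAux : AltRing n R →ₐ[R] HomRing r n R :=
  MvPolynomial.aeval fun p => pulledBackForm r n R p.1.1 p.1.2

variable {R} in
theorem conj_formMatrix_diag {B : Type*} [CommRing B] (X : Matrix (Fin r ⊕ Fin r) (Fin n) B)
    (i : Fin n) : (Xᵀ * formMatrix r B * X) i i = 0 := by
  simp only [formMatrix, Matrix.mul_apply, Matrix.transpose_apply, Fintype.sum_sum_type,
    Matrix.fromBlocks_apply₁₁, Matrix.fromBlocks_apply₁₂, Matrix.fromBlocks_apply₂₁,
    Matrix.fromBlocks_apply₂₂, antidiagonalMatrix, Matrix.of_apply, Matrix.neg_apply,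
    Matrix.zero_apply]
  have h : ∀ i j : Fin r, j = i.rev ↔ i = j.rev := fun i j => by rw [← Fin.rev_eq_iff, eq_comm]
  simp only [h, mul_zero, Finset.sum_const_zero, mul_neg, mul_ite, mul_one, zero_add, add_zero,
    Finset.sum_neg_distrib, Finset.sum_ite_eq', Finset.mem_univ, if_true]
  rw [← Equiv.sum_comp Fin.revPerm fun x => -X (Sum.inr x.rev) i * X (Sum.inl x) i]
  simp [mul_comm]

theorem map_genericAlternating_coquotientAux :
    (genericAlternating n R).map (coquotientAux r n R) = pulledBackForm r n R := by
  ext1 i j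
  simp only [Matrix.map_apply, genericAlternating, alternatingMatrix, Matrix.of_apply]
  split_ifs with h h'
  · exact MvPolynomial.aeval_X _ _
  · rw [map_neg]
    refine (congrArg _ (MvPolynomial.aeval_X _ _)).trans ?_
    have : (pulledBackForm r n R)ᵀ = -pulledBackForm r n R := by
      simp [pulledBackForm, Matrix.transpose_mul, formMatrix_transpose, Matrix.mul_assoc]
    exact (congrFun (congrFun this j) i).symm.trans rfl
  · obtain rfl : i = j := le_antisymm (not_lt.1 h') (not_lt.1 h)
    rw [map_zero]
    exact (conj_formMatrix_diag r n _ i).symm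

/-- The comorphism of `π : Hom(V, E) → Y_s`, `φ ↦ ρ ∘ ⋀²φ`. -/
def coquotient (s : ℕ) (h : r < s) : PfaffianRing n s R →ₐ[R] HomRing r n R :=
  Ideal.Quotient.liftₐ (pfaffianIdeal n s R) (coquotientAux r n R) (by
    intro a ha
    have : pfaffianIdeal n s R ≤ RingHom.ker (coquotientAux r n R) := by
      refine Ideal.span_le.2 ?_
      rintro _ ⟨e, rfl⟩
      have key := pfaffian_conj_eq_zero (m := s) (ι := Fin r ⊕ Fin r) (by simp; omega)
        (formMatrix r ℤ) (formMatrix_apply_swap r ℤ)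
        ((genericMatrix (Fin r ⊕ Fin r) (Fin n) R).submatrix id e)
      have hJ : (formMatrix r ℤ).map (Int.cast : ℤ → HomRing r n R) = formMatrix r _ :=
        map_formMatrix r (Int.castRingHom (HomRing r n R))
      rw [SetLike.mem_coe, RingHom.mem_ker, ← AlgHom.coe_toRingHom, map_pfaffian,
        AlgHom.coe_toRingHom, ← Matrix.submatrix_map, map_genericAlternating_coquotientAux]
      rw [hJ] at key
      exact key
    exact this ha)

end comorphisms

/-! ### The symplectic group scheme, its action and the quotient morphism -/

section coactionAxioms

open scoped TensorProduct
open Algebra.TensorProduct (includeLeft includeRight)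

variable (r n : ℕ) (R : Type u) [CommRing R]

theorem map_coaction : (genericMatrix (Fin r ⊕ Fin r) (Fin n) R).map (coaction r n R) =
    (SymplecticRing.generic r R).map (includeLeft (R := R) (S := R) (B := HomRing r n R)) *
      (genericMatrix (Fin r ⊕ Fin r) (Fin n) R).map
        (includeRight (R := R) (A := SymplecticRing r R)) :=
  map_genericMatrix_aeval _

theorem HomRing.algHom_ext {r n : ℕ} {R : Type u} [CommRing R] {B : Type*} [CommRing B]
    [Algebra R B] {f g : HomRing r n R →ₐ[R] B}
    (h : (genericMatrix (Fin r ⊕ Fin r) (Fin n) R).map f =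
      (genericMatrix (Fin r ⊕ Fin r) (Fin n) R).map g) : f = g :=
  MvPolynomial.algHom_ext fun p => congrFun (congrFun h p.1) p.2

theorem counit_coaction :
    (Algebra.TensorProduct.map (Bialgebra.counitAlgHom R (SymplecticRing r R))
      (AlgHom.id R (HomRing r n R))).comp (coaction r n R) =
      (Algebra.TensorProduct.lid R (HomRing r n R)).symm.toAlgHom := by
  refine HomRing.algHom_ext ?_
  have h1 : ((SymplecticRing.generic r R).map
      (includeLeft (R := R) (S := R) (B := HomRing r n R))).map
      (Algebra.TensorProduct.map (Bialgebra.counitAlgHom R (SymplecticRing r R))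
        (AlgHom.id R (HomRing r n R))) =
      ((SymplecticRing.generic r R).map (SymplecticRing.counit r R)).map
        (includeLeft (R := R) (S := R) (B := HomRing r n R)) := by
    ext i j
    exact (Algebra.TensorProduct.map_tmul _ _ _ _).trans (by simp; rfl)
  rw [← SymplecticRing.map_comp_matrix, map_coaction, Matrix.map_mul, h1,
    SymplecticRing.map_counit, Matrix.map_one _ (map_zero _) (map_one _), Matrix.one_mul]
  ext i j
  simp

theorem comul_coaction :
    (Algebra.TensorProduct.map (Bialgebra.comulAlgHom R (SymplecticRing r R))
      (AlgHom.id R (HomRing r n R))).comp (coaction r n R) =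
    (Algebra.TensorProduct.assoc R R R _ _ _).symm.toAlgHom.comp
      ((Algebra.TensorProduct.map (AlgHom.id R (SymplecticRing r R)) (coaction r n R)).comp
        (coaction r n R)) := by
  refine HomRing.algHom_ext ?_
  have h1 : ((SymplecticRing.generic r R).map
      (includeLeft (R := R) (S := R) (B := HomRing r n R))).map
      (Algebra.TensorProduct.map (Bialgebra.comulAlgHom R (SymplecticRing r R))
        (AlgHom.id R (HomRing r n R))) =
      ((SymplecticRing.generic r R).map (SymplecticRing.comul r R)).map
        (includeLeft (R := R) (S := R) (B := HomRing r n R)) := by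
    ext i j
    exact (Algebra.TensorProduct.map_tmul _ _ _ _).trans (by simp; rfl)
  have h2 : ((genericMatrix (Fin r ⊕ Fin r) (Fin n) R).map
        (includeRight (R := R) (A := SymplecticRing r R))).map
      (Algebra.TensorProduct.map (AlgHom.id R (SymplecticRing r R)) (coaction r n R)) =
      ((genericMatrix (Fin r ⊕ Fin r) (Fin n) R).map (coaction r n R)).map
        (includeRight (R := R) (A := SymplecticRing r R)) := by
    ext i j
    simp
  change ((genericMatrix (Fin r ⊕ Fin r) (Fin n) R).map (coaction r n R)).map
      (Algebra.TensorProduct.map (Bialgebra.comulAlgHom R (SymplecticRing r R))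
        (AlgHom.id R (HomRing r n R))) =
    (((genericMatrix (Fin r ⊕ Fin r) (Fin n) R).map (coaction r n R)).map
      (Algebra.TensorProduct.map (AlgHom.id R (SymplecticRing r R)) (coaction r n R))).map
        (Algebra.TensorProduct.assoc R R R (SymplecticRing r R) (SymplecticRing r R)
          (HomRing r n R)).symm
  rw [map_coaction, Matrix.map_mul, h1, SymplecticRing.map_comul,
    Matrix.map_mul, Matrix.map_mul, h2, map_coaction, Matrix.map_mul, Matrix.map_mul,
    Matrix.map_mul, Matrix.mul_assoc]
  refine congrArg₂ _ ?_ (congrArg₂ _ ?_ ?_)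
  · ext i j; simp [Algebra.TensorProduct.one_def]
  · ext i j; simp
  · ext i j; simp [Algebra.TensorProduct.one_def]

/-- `π` is invariant, on the level of comorphisms. -/
theorem coaction_comp_coquotient (s : ℕ) (h : r < s) :
    (coaction r n R).comp (coquotient r n R s h) =
      (includeRight (R := R) (A := SymplecticRing r R)).comp (coquotient r n R s h) := by
  refine Ideal.Quotient.algHom_ext _ (MvPolynomial.algHom_ext fun p => ?_)
  have key : (pulledBackForm r n R).map (coaction r n R) =
      (pulledBackForm r n R).map (includeRight (R := R) (A := SymplecticRing r R)) := by
    simp only [pulledBackForm, Matrix.map_mul, Matrix.transpose_map, map_coaction, map_formMatrix,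
      Matrix.transpose_mul]
    conv_rhs => rw [← SymplecticRing.map_generic_rel
      (includeLeft (R := R) (S := R) (A := SymplecticRing r R) (B := HomRing r n R))]
    simp only [Matrix.mul_assoc]
  have h0 : coquotientAux r n R (MvPolynomial.X p) = pulledBackForm r n R p.1.1 p.1.2 :=
    MvPolynomial.aeval_X _ _
  change coaction r n R (coquotientAux r n R (MvPolynomial.X p)) =
    includeRight (R := R) (A := SymplecticRing r R) (coquotientAux r n R (MvPolynomial.X p))
  rw [h0]
  exact congrFun (congrFun key p.1.1) p.1.2

end coactionAxioms

open CategoryTheory AlgebraicGeometry MonoidalCategory CartesianMonoidalCategory Opposite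
open scoped MonObj

/-- A lax monoidal functor sends actions to actions. -/
abbrev mapModObj {C D : Type*} [Category C] [Category D] [MonoidalCategory C] [MonoidalCategory D]
    (F : C ⥤ D) [F.LaxMonoidal] (G X : C) [MonObj G] [ModObj G X] :
    letI := F.monObjObj (X := G)
    ModObj (F.obj G) (F.obj X) :=
  letI := F.monObjObj (X := G)
  { smul := Functor.LaxMonoidal.μ F G X ≫ F.map γ[G, X]
    one_smul := by
      change (Functor.LaxMonoidal.ε F ≫ F.map η[G]) ▷ F.obj X ≫
        Functor.LaxMonoidal.μ F G X ≫ F.map γ[G, X] = (λ_ (F.obj X)).hom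
      simp only [comp_whiskerRight, Category.assoc, Functor.LaxMonoidal.μ_natural_left_assoc,
        ← F.map_comp, ModObj.one_smul_self, ← Functor.LaxMonoidal.left_unitality]
    mul_smul := by
      change (Functor.LaxMonoidal.μ F G G ≫ F.map μ[G]) ▷ F.obj X ≫
        Functor.LaxMonoidal.μ F G X ≫ F.map γ[G, X] = (α_ (F.obj G) (F.obj G) (F.obj X)).hom ≫
          F.obj G ◁ (Functor.LaxMonoidal.μ F G X ≫ F.map γ[G, X]) ≫
            Functor.LaxMonoidal.μ F G X ≫ F.map γ[G, X]
      simp only [comp_whiskerRight, Category.assoc, Functor.LaxMonoidal.μ_natural_left_assoc,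
        ← F.map_comp, ModObj.mul_smul_self, MonoidalCategory.whiskerLeft_comp,
        Functor.LaxMonoidal.μ_natural_right_assoc]
      simp only [F.map_comp, Functor.LaxMonoidal.associativity_assoc] }

section schemes

variable (r n : ℕ) (k : Type u) [CommRing k]

instance algSpecMonoidal : (algSpec (CommRingCat.of k)).Monoidal :=
  (braidedAlgSpec (R := CommRingCat.of k)).toMonoidal

/-- The affine `k`-scheme with coordinate ring `A`. -/
abbrev specOver (A : Type u) [CommRing A] [Algebra k A] : Over (Spec (CommRingCat.of k)) :=
  (algSpec (CommRingCat.of k)).obj (op (CommAlgCat.of k A))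

/-- The symplectic group scheme of `E = k^{2r}`. -/
def symplecticGroupScheme : Over (Spec (CommRingCat.of k)) :=
  specOver k (SymplecticRing r k)

instance : GrpObj (symplecticGroupScheme r k) :=
  (algSpec (CommRingCat.of k)).grpObjObj (G := op (CommAlgCat.of k (SymplecticRing r k)))

/-- The scheme `M = Hom(V, E)`. -/
def homScheme : Over (Spec (CommRingCat.of k)) :=
  specOver k (HomRing r n k)

instance modObjOp : ModObj (op (CommAlgCat.of k (SymplecticRing r k)))
    (op (CommAlgCat.of k (HomRing r n k))) where
  smul := (CommAlgCat.ofHom (coaction r n k)).op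
  one_smul := by
    apply Quiver.Hom.unop_inj
    ext1
    exact counit_coaction r n k
  mul_smul := by
    apply Quiver.Hom.unop_inj
    ext1
    exact comul_coaction r n k

/-- The natural action of the symplectic group on `M = Hom(V, E)`. -/
instance : ModObj (symplecticGroupScheme r k) (homScheme r n k) :=
  mapModObj (algSpec (CommRingCat.of k)) (op (CommAlgCat.of k (SymplecticRing r k)))
    (op (CommAlgCat.of k (HomRing r n k)))

end schemes

section quotient

variable (r n s : ℕ) (k : Type u) [CommRing k]

/-- The scheme `Y_s` of alternating `n × n` matrices all of whose main `2s × 2s` submatrices have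
vanishing Pfaffian. -/
def pfaffianScheme : Over (Spec (CommRingCat.of k)) :=
  specOver k (PfaffianRing n s k)

/-- The morphism `π : Hom(V, E) → Y_s`, `φ ↦ ρ ∘ ⋀²φ`, where `2r = dim E` and `r < s`. -/
def quotientMorphism (h : r < s) : homScheme r n k ⟶ pfaffianScheme n s k :=
  (algSpec (CommRingCat.of k)).map (CommAlgCat.ofHom (coquotient r n k s h)).op

/-- `π` is invariant under the symplectic group. -/
theorem smul_quotientMorphism (h : r < s) :
    γ[symplecticGroupScheme r k, homScheme r n k] ≫ quotientMorphism r n s k h =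
      snd (symplecticGroupScheme r k) (homScheme r n k) ≫ quotientMorphism r n s k h := by
  let F := algSpec (CommRingCat.of k)
  let A : (CommAlgCat k)ᵒᵖ := op (CommAlgCat.of k (SymplecticRing r k))
  let T : (CommAlgCat k)ᵒᵖ := op (CommAlgCat.of k (HomRing r n k))
  let Y : (CommAlgCat k)ᵒᵖ := op (CommAlgCat.of k (PfaffianRing n s k))
  let q : T ⟶ Y := (CommAlgCat.ofHom (coquotient r n k s h)).op
  have h1 : γ[A, T] ≫ q = snd A T ≫ q := by
    apply Quiver.Hom.unop_inj
    ext1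
    exact coaction_comp_coquotient r n k s h
  change (Functor.LaxMonoidal.μ F A T ≫ F.map γ[A, T]) ≫ F.map q =
    snd (F.obj A) (F.obj T) ≫ F.map q
  rw [Category.assoc, ← F.map_comp, h1, F.map_comp, ← Category.assoc, Functor.Monoidal.μ_snd]

/-- The affine space of alternating `n × n` matrices. -/
def altScheme : Over (Spec (CommRingCat.of k)) :=
  specOver k (AltRing n k)

/-- The inclusion of `Y_s` into the space of all alternating matrices. -/
def pfaffianInclusion : pfaffianScheme n s k ⟶ altScheme n k :=
  (algSpec (CommRingCat.of k)).map (CommAlgCat.ofHom (PfaffianRing.mk n s k)).op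

/-- The set of points `x` of the space of alternating `n × n` matrices such that the alternating
matrix over the residue field of `x` that corresponds to `x` has rank exactly `d`. -/
def exactRankLocus (d : ℕ) : Set (altScheme n k).left :=
  {x : PrimeSpectrum (AltRing n k) |
    ((genericAlternating n k).map (algebraMap (AltRing n k) x.asIdeal.ResidueField)).rank = d}

/-- The open subscheme `Y_s ∖ Y_r` of `Y_s`. -/
def pfaffianOpen : (pfaffianScheme n s k).left.Opens :=
  ⟨(PrimeSpectrum.zeroLocus
      ((pfaffianIdeal n r k).map (PfaffianRing.mk n s k) : Set (PfaffianRing n s k)))ᶜ,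
    (PrimeSpectrum.isClosed_zeroLocus _).isOpen_compl⟩

end quotient

section restriction

variable {S : Scheme.{u}}

/-- An open subscheme of an `S`-scheme, as an `S`-scheme. -/
def openSubscheme (X : Over S) (U : X.left.Opens) : Over S :=
  Over.mk (U.ι ≫ X.hom)

/-- The inclusion of an open subscheme. -/
def openSubschemeι (X : Over S) (U : X.left.Opens) : openSubscheme X U ⟶ X :=
  Over.homMk U.ι rfl

/-- The restriction `f⁻¹(U) → U` of `f : X → Y`. -/
def restrictHom {X Y : Over S} (f : X ⟶ Y) (U : Y.left.Opens) :
    openSubscheme X (f.left ⁻¹ᵁ U) ⟶ openSubscheme Y U :=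
  Over.homMk (f.left ∣_ U) (by simp [openSubscheme])

instance (X : Over S) (U : X.left.Opens) : Mono (openSubschemeι X U) := by
  have : Mono (openSubschemeι X U).left := inferInstanceAs (Mono U.ι)
  exact Over.mono_of_mono_left _

theorem smul_mem_preimage {G X Y : Over S} [MonObj G] [ModObj G X] (f : X ⟶ Y)
    (hf : γ[G, X] ≫ f = snd G X ≫ f) (U : Y.left.Opens) :
    Set.range (G ◁ openSubschemeι X (f.left ⁻¹ᵁ U) ≫ γ[G, X]).left ⊆
      Set.range (f.left ⁻¹ᵁ U).ι := by
  rintro _ ⟨p, rfl⟩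
  rw [Scheme.Opens.range_ι]
  change (f.left ((G ◁ openSubschemeι X (f.left ⁻¹ᵁ U) ≫ γ[G, X]).left p)) ∈ U
  have h1 : (G ◁ openSubschemeι X (f.left ⁻¹ᵁ U) ≫ γ[G, X]) ≫ f =
      snd G _ ≫ openSubschemeι X (f.left ⁻¹ᵁ U) ≫ f := by
    rw [Category.assoc, hf, whiskerLeft_snd_assoc]
  have h2 := congrArg (fun g => g.left p) h1
  simp only [Over.comp_left, Scheme.Hom.comp_apply] at h2 ⊢
  rw [h2]
  exact ((snd G (openSubscheme X (f.left ⁻¹ᵁ U))).left p).2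

/-- The action map `G × f⁻¹(U) → f⁻¹(U)` as a morphism of schemes. -/
def restrictSMulLeft {G X Y : Over S} [MonObj G] [ModObj G X] (f : X ⟶ Y)
    (hf : γ[G, X] ≫ f = snd G X ≫ f) (U : Y.left.Opens) :
    (G ⊗ openSubscheme X (f.left ⁻¹ᵁ U)).left ⟶ (f.left ⁻¹ᵁ U).toScheme :=
  IsOpenImmersion.lift (f.left ⁻¹ᵁ U).ι
    (G ◁ openSubschemeι X (f.left ⁻¹ᵁ U) ≫ γ[G, X]).left (smul_mem_preimage f hf U)

theorem restrictSMulLeft_ι {G X Y : Over S} [MonObj G] [ModObj G X] (f : X ⟶ Y)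
    (hf : γ[G, X] ≫ f = snd G X ≫ f) (U : Y.left.Opens) :
    restrictSMulLeft f hf U ≫ (f.left ⁻¹ᵁ U).ι =
      (G ◁ openSubschemeι X (f.left ⁻¹ᵁ U) ≫ γ[G, X]).left :=
  IsOpenImmersion.lift_fac _ _ _

/-- The action map `G × f⁻¹(U) → f⁻¹(U)`. -/
def restrictSMul {G X Y : Over S} [MonObj G] [ModObj G X] (f : X ⟶ Y)
    (hf : γ[G, X] ≫ f = snd G X ≫ f) (U : Y.left.Opens) :
    G ⊗ openSubscheme X (f.left ⁻¹ᵁ U) ⟶ openSubscheme X (f.left ⁻¹ᵁ U) :=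
  Over.homMk (restrictSMulLeft f hf U) (by
    have h1 : restrictSMulLeft f hf U ≫ (f.left ⁻¹ᵁ U).ι ≫ X.hom =
        (G ⊗ openSubscheme X (f.left ⁻¹ᵁ U)).hom := by
      rw [← Category.assoc, restrictSMulLeft_ι]
      exact Over.w _
    exact h1)

theorem restrictSMul_ι {G X Y : Over S} [MonObj G] [ModObj G X] (f : X ⟶ Y)
    (hf : γ[G, X] ≫ f = snd G X ≫ f) (U : Y.left.Opens) :
    restrictSMul f hf U ≫ openSubschemeι X (f.left ⁻¹ᵁ U) =
      G ◁ openSubschemeι X (f.left ⁻¹ᵁ U) ≫ γ[G, X] := by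
  ext1
  exact restrictSMulLeft_ι f hf U

/-- The restriction of an action on `X` to the preimage of an open subscheme under an invariant
morphism `f : X → Y`. -/
abbrev restrictModObj {G X Y : Over S} [MonObj G] [ModObj G X] (f : X ⟶ Y)
    (hf : γ[G, X] ≫ f = snd G X ≫ f) (U : Y.left.Opens) :
    ModObj G (openSubscheme X (f.left ⁻¹ᵁ U)) where
  smul := restrictSMul f hf U
  one_smul := by
    change η[G] ▷ openSubscheme X (f.left ⁻¹ᵁ U) ≫ restrictSMul f hf U = (λ_ _).hom
    rw [← cancel_mono (openSubschemeι X (f.left ⁻¹ᵁ U)), Category.assoc, restrictSMul_ι,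
      ← whisker_exchange_assoc, ModObj.one_smul_self, leftUnitor_naturality]
  mul_smul := by
    change μ[G] ▷ openSubscheme X (f.left ⁻¹ᵁ U) ≫ restrictSMul f hf U =
      (α_ _ _ _).hom ≫ G ◁ restrictSMul f hf U ≫ restrictSMul f hf U
    rw [← cancel_mono (openSubschemeι X (f.left ⁻¹ᵁ U))]
    simp only [Category.assoc, restrictSMul_ι]
    rw [← whisker_exchange_assoc, ModObj.mul_smul_self, ← whiskerLeft_comp_assoc, restrictSMul_ι]
    simp

/-- Let `G` be a group scheme over `S` that acts on `X`. A morphism `f : X → Y` of `S`-schemes is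
a principal `G`-bundle if it is faithfully flat and `G`-invariant and
`Φ : G × X → X ×_Y X`, `(g, x) ↦ (g x, x)`, is an isomorphism. -/
structure IsPrincipalBundle (G : Over S) {X Y : Over S} [GrpObj G] [ModObj G X] (f : X ⟶ Y) :
    Prop where
  flat : Flat f.left
  surjective : Surjective f.left
  invariant : γ[G, X] ≫ f = snd G X ≫ f
  isIso : IsIso (Limits.pullback.lift (f := f.left) (g := f.left) (γ[G, X] : G ⊗ X ⟶ X).left
    (snd G X).left (congrArg CommaMorphism.left invariant))

end restriction

section main

variable (r n s : ℕ) (h : r < s) (k : Type u) [CommRing k]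

/-- `π⁻¹(U)` for `U = Y_s ∖ Y_r`. -/
def quotientPreimage : Over (Spec (CommRingCat.of k)) :=
  openSubscheme (homScheme r n k) ((quotientMorphism r n s k h).left ⁻¹ᵁ pfaffianOpen r n s k)

instance : ModObj (symplecticGroupScheme r k) (quotientPreimage r n s h k) :=
  restrictModObj (quotientMorphism r n s k h) (smul_quotientMorphism r n s k h)
    (pfaffianOpen r n s k)

/-- The restriction `π⁻¹(U) → U` of `π`, for `U = Y_s ∖ Y_r`. -/
def restrictedQuotient : quotientPreimage r n s h k ⟶
    openSubscheme (pfaffianScheme n s k) (pfaffianOpen r n s k) :=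
  restrictHom (quotientMorphism r n s k h) (pfaffianOpen r n s k)

end main

end SymplecticInvariants

end

open SymplecticInvariants

/-!
Write `J` for the Gram matrix of the form on `E`. Where the Pfaffian of the main submatrix `A_e` of
`A` at the indices `e` is invertible, a solution `X` of `Xᵀ J X = A` is determined by its columns
`X_e`: one has `X = X_e A_e⁻¹ A_{e,•}`. Hence two solutions `X`, `Y` of the same equation, over any
ring, satisfy `X = g Y` for exactly one symplectic `g`, namely `g = X_e A_e⁻¹ Y_eᵀ J`, and `Φ` is an
isomorphism by the Yoneda lemma. On the same locus solutions lift along square-zero extensions: lift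
`X_e` first, by one Newton step, and then define the other columns by the formula above. So `π` is
smooth there, hence flat. It is surjective because an invertible alternating matrix `A_e` over a
field has a symplectic basis, which gives `X_e` and then `X`.
-/

noncomputable section

namespace SymplecticInvariants

universe u v

/-! ### Alternating matrices -/

section alternating

variable {R S ι κ κ' : Type*} [CommRing R] [CommRing S]

/-- A matrix is alternating if it is the Gram matrix of an alternating bilinear form, that is, if it
is skew-symmetric with zeros on the diagonal. The second condition matters where `2` is a zero
divisor. -/
structure IsAlternating (A : Matrix ι ι R) : Prop where
  apply_swap : ∀ i j, A i j = -A j i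
  apply_self : ∀ i, A i i = 0

theorem transpose_mul_mul_apply [Fintype κ] (X : Matrix κ ι R) (M : Matrix κ κ R) (i j : ι) :
    (Xᵀ * M * X) i j = ∑ p : κ × κ, M p.1 p.2 * (X p.1 i * X p.2 j) := by
  simp only [Matrix.mul_apply, Finset.sum_mul, Matrix.transpose_apply, Fintype.sum_prod_type]
  rw [Finset.sum_comm]
  exact Finset.sum_congr rfl fun p _ => Finset.sum_congr rfl fun q _ => by ring

namespace IsAlternating

variable {A B : Matrix ι ι R}

theorem transpose_submatrix (hA : IsAlternating A) (e : κ → ι) (f : κ' → ι) :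
    (A.submatrix e f)ᵀ = -A.submatrix f e := by
  ext1 i j
  exact hA.apply_swap _ _

theorem transpose_eq (hA : IsAlternating A) : Aᵀ = -A :=
  hA.transpose_submatrix id id

theorem submatrix (hA : IsAlternating A) (e : κ → ι) : IsAlternating (A.submatrix e e) :=
  ⟨fun _ _ => hA.apply_swap _ _, fun _ => hA.apply_self _⟩

theorem map (hA : IsAlternating A) (f : R →+* S) : IsAlternating (A.map f) :=
  ⟨fun i j => by simp [hA.apply_swap i j], fun i => by simp [hA.apply_self i]⟩

theorem neg (hA : IsAlternating A) : IsAlternating (-A) :=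
  ⟨fun i j => by simp [hA.apply_swap i j], fun i => by simp [hA.apply_self i]⟩

theorem sub (hA : IsAlternating A) (hB : IsAlternating B) : IsAlternating (A - B) :=
  ⟨fun i j => by simp [hA.apply_swap i j, hB.apply_swap i j, sub_eq_neg_add, add_comm],
    fun i => by simp [hA.apply_self i, hB.apply_self i]⟩

theorem conj [Fintype ι] (hA : IsAlternating A) (X : Matrix ι κ R) :
    IsAlternating (Xᵀ * A * X) where
  apply_swap i j := by
    rw [← Matrix.transpose_apply (Xᵀ * A * X) i j, Matrix.transpose_mul, Matrix.transpose_mul,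
      hA.transpose_eq, Matrix.transpose_transpose, Matrix.neg_mul, Matrix.mul_neg,
      Matrix.mul_assoc, Matrix.neg_apply, neg_neg]
  apply_self i := by
    classical
    rw [transpose_mul_mul_apply]
    refine Finset.sum_involution (fun p _ => p.swap) ?_ ?_ (by simp) (by simp)
    · rintro ⟨p, q⟩ -
      simp only [Prod.fst_swap, Prod.snd_swap, hA.apply_swap q p]
      ring
    · rintro ⟨p, q⟩ - hpq hswap
      obtain rfl : q = p := congrArg Prod.fst hswap
      simp [hA.apply_self] at hpq

variable [Fintype ι] [DecidableEq ι]

theorem transpose_inv (hA : IsAlternating A) (h : IsUnit A.det) : A⁻¹ᵀ = -A⁻¹ := by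
  rw [Matrix.transpose_nonsing_inv, hA.transpose_eq]
  refine Matrix.inv_eq_left_inv ?_
  rw [Matrix.neg_mul, Matrix.mul_neg, neg_neg, Matrix.nonsing_inv_mul _ h]

theorem inv (hA : IsAlternating A) (h : IsUnit A.det) : IsAlternating A⁻¹ := by
  have hconj : A⁻¹ᵀ * A * A⁻¹ = -A⁻¹ := by
    rw [Matrix.mul_assoc, Matrix.mul_nonsing_inv _ h, Matrix.mul_one, hA.transpose_inv h]
  have := (hA.conj A⁻¹).neg
  rwa [hconj, neg_neg] at this

end IsAlternating

theorem isAlternating_alternatingMatrix {n : ℕ} (a : {p : Fin n × Fin n // p.1 < p.2} → R) :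
    IsAlternating (alternatingMatrix a) where
  apply_swap i j := by
    simp only [alternatingMatrix, Matrix.of_apply]
    rcases lt_trichotomy i j with h | h | h
    · simp [h, h.not_gt]
    · simp [h]
    · simp [h, h.not_gt]
  apply_self i := by simp [alternatingMatrix]

theorem IsAlternating.alternatingMatrix_eq {n : ℕ} {A : Matrix (Fin n) (Fin n) R}
    (hA : IsAlternating A) : alternatingMatrix (fun p => A p.1.1 p.1.2) = A := by
  ext i j
  simp only [alternatingMatrix, Matrix.of_apply]
  split_ifs with h h'
  · rfl
  · rw [hA.apply_swap i j]
  · obtain rfl : i = j := le_antisymm (not_lt.1 h') (not_lt.1 h)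
    rw [hA.apply_self]

theorem map_alternatingMatrix {n : ℕ} (f : R →+* S) (a : {p : Fin n × Fin n // p.1 < p.2} → R) :
    (alternatingMatrix a).map f = alternatingMatrix (f ∘ a) := by
  ext i j
  simp only [alternatingMatrix, Matrix.of_apply, Matrix.map_apply]
  split_ifs <;> simp

theorem isAlternating_genericAlternating (n : ℕ) (R : Type u) [CommRing R] :
    IsAlternating (genericAlternating n R) :=
  isAlternating_alternatingMatrix _

theorem IsAlternating.exists_map_genericAlternating {n : ℕ} {A : Matrix (Fin n) (Fin n) R}
    (hA : IsAlternating A) :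
    ∃ f : AltRing n ℤ →+* R, (genericAlternating n ℤ).map f = A := by
  refine ⟨MvPolynomial.eval₂Hom (Int.castRingHom R) fun p => A p.1.1 p.1.2, ?_⟩
  rw [genericAlternating, map_alternatingMatrix]
  convert hA.alternatingMatrix_eq using 2
  funext p
  simp

theorem map_inv_of_isUnit_det [Fintype ι] [DecidableEq ι] (f : R →+* S) {A : Matrix ι ι R}
    (h : IsUnit A.det) : A⁻¹.map f = (A.map f)⁻¹ := by
  refine (Matrix.inv_eq_left_inv ?_).symm
  rw [← Matrix.map_mul, Matrix.nonsing_inv_mul _ h, Matrix.map_one f (map_zero f) (map_one f)]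

end alternating

/-! ### Symplectic bases over fields -/

section symplecticBasis

theorem isAlternating_formMatrix (r : ℕ) (R : Type*) [CommRing R] :
    IsAlternating (formMatrix r R) where
  apply_swap := formMatrix_apply_swap r R
  apply_self := by rintro (_ | _) <;> simp [formMatrix]

theorem conj_formMatrix_eq {R ι : Type*} [CommRing R] {r : ℕ} (U V : Matrix (Fin r) ι R) :
    (Matrix.fromRows U (V.submatrix Fin.rev id))ᵀ * formMatrix r R *
      Matrix.fromRows U (V.submatrix Fin.rev id) = Uᵀ * V - Vᵀ * U := by
  have hJ : antidiagonalMatrix r R = (1 : Matrix (Fin r) (Fin r) R).submatrix Fin.rev id := by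
    ext i j
    simp [antidiagonalMatrix, Matrix.one_apply, eq_comm]
  have hU : antidiagonalMatrix r R * V.submatrix Fin.rev id = V := by
    rw [hJ]
    ext i j
    simp [Matrix.mul_apply, Matrix.one_apply]
  have hV : (V.submatrix Fin.rev id)ᵀ * antidiagonalMatrix r R = Vᵀ := by
    rw [hJ]
    ext i j
    simp [Matrix.mul_apply, Matrix.one_apply, Fin.rev_eq_iff]
  rw [formMatrix, Matrix.transpose_fromRows, Matrix.fromCols_mul_fromBlocks,
    Matrix.fromCols_mul_fromRows]
  simp only [Matrix.mul_zero, zero_add, add_zero, Matrix.mul_neg, Matrix.neg_mul, hV,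
    Matrix.mul_assoc, hU]
  abel

variable {F ι : Type*} [Field F]

theorem IsAlternating.exists_sub_vecMulVec {A : Matrix ι ι F} (hA : IsAlternating A) {p q : ι}
    (hpq : A p q ≠ 0) :
    ∃ u v : ι → F, ∃ B : Matrix ι ι F, A = vecMulVec u v - vecMulVec v u + B ∧
      IsAlternating B ∧ B p = 0 ∧ B q = 0 ∧ ∀ i, A i = 0 → B i = 0 := by
  let u : ι → F := fun i => A i q / A p q
  let B : Matrix ι ι F := Matrix.of fun i j => A i j - (u i * A p j - A p i * u j)
  refine ⟨u, A p, B, ?_, ⟨fun i j => ?_, fun i => ?_⟩, ?_, ?_, fun i hi => ?_⟩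
  · ext i j
    simp [B, vecMulVec_apply]
  · simp only [B, Matrix.of_apply, hA.apply_swap i j]
    ring
  · simp only [B, Matrix.of_apply, hA.apply_self i]
    ring
  · ext j
    simp [B, u, hA.apply_self, hpq]
  · ext j
    simp only [B, u, Matrix.of_apply, Pi.zero_apply, hA.apply_self, hA.apply_swap q j]
    field_simp
    ring
  · ext j
    simp [B, u, hA.apply_swap p i, hi]

theorem IsAlternating.exists_eq_transpose_mul_sub {m : ℕ} :
    ∀ {A : Matrix ι ι F} {s : Finset ι}, IsAlternating A → (∀ i ∉ s, A i = 0) → s.card ≤ 2 * m →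
      ∃ U V : Matrix (Fin m) ι F, A = Uᵀ * V - Vᵀ * U := by
  classical
  induction m with
  | zero =>
    intro A s _ hs hm
    obtain rfl : s = ∅ := by simpa using hm
    exact ⟨0, 0, by ext i j; simp [hs i]⟩
  | succ m ih =>
    intro A s hA hs hm
    by_cases hA0 : A = 0
    · exact ⟨0, 0, by simp [hA0]⟩
    obtain ⟨p, q, hpq⟩ : ∃ p q, A p q ≠ 0 := by
      by_contra! h
      exact hA0 (Matrix.ext h)
    have hp : p ∈ s := by_contra fun h => hpq (congrFun (hs p h) q)
    have hq : q ∈ s :=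
      by_contra fun h => hpq (by rw [hA.apply_swap, hs q h, Pi.zero_apply, neg_zero])
    have hne : q ≠ p := fun h => hpq (h ▸ hA.apply_self p)
    obtain ⟨u, v, B, rfl, hB, hBp, hBq, hB0⟩ := hA.exists_sub_vecMulVec hpq
    have hBs : ∀ i ∉ (s.erase p).erase q, B i = 0 := fun i hi => by
      rcases eq_or_ne i q with rfl | hiq
      · exact hBq
      rcases eq_or_ne i p with rfl | hip
      · exact hBp
      exact hB0 i (hs i fun h => hi (by simp [hiq, hip, h]))
    have hcard : ((s.erase p).erase q).card ≤ 2 * m := by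
      rw [Finset.card_erase_of_mem (Finset.mem_erase.2 ⟨hne, hq⟩), Finset.card_erase_of_mem hp]
      omega
    obtain ⟨U, V, rfl⟩ := ih hB hBs hcard
    refine ⟨Matrix.of (vecCons u fun k => U k), Matrix.of (vecCons v fun k => V k), ?_⟩
    ext i j
    simp only [Matrix.add_apply, Matrix.sub_apply, Matrix.mul_apply, Matrix.transpose_apply,
      Fin.sum_univ_succ, Matrix.of_apply, Matrix.cons_val_zero, Matrix.cons_val_succ,
      vecMulVec_apply]
    ring

theorem IsAlternating.exists_conj_formMatrix_eq [Fintype ι] {m : ℕ}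
    (hm : Fintype.card ι ≤ 2 * m) {A : Matrix ι ι F} (hA : IsAlternating A) :
    ∃ X : Matrix (Fin m ⊕ Fin m) ι F, Xᵀ * formMatrix m F * X = A := by
  obtain ⟨U, V, h⟩ := hA.exists_eq_transpose_mul_sub (s := Finset.univ) (by simp) hm
  exact ⟨_, (conj_formMatrix_eq U V).trans h.symm⟩

end symplecticBasis

/-! ### The Pfaffian squares to the determinant -/

section pfaffian

/-- A map on `2m` positions is the family of its values on the `m` pairs of positions. -/
def pairsEquiv (m : ℕ) (ι : Type*) : (Fin m → ι × ι) ≃ (Fin (2 * m) → ι) where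
  toFun g a := bif ((pairIdx m).symm a).2 then (g ((pairIdx m).symm a).1).2
    else (g ((pairIdx m).symm a).1).1
  invFun f i := (f (evenIdx i), f (oddIdx i))
  left_inv g := by
    funext i
    simp [← pairIdx_false, ← pairIdx_true]
  right_inv f := by
    funext a
    obtain ⟨⟨i, _ | _⟩, rfl⟩ := (pairIdx m).surjective a <;>
      simp only [Equiv.symm_apply_apply] <;> rfl

variable {R : Type*} [CommRing R] {m : ℕ}

theorem prod_pairs_eq_prod {M : Type*} [CommMonoid M] (c : Fin (2 * m) → M) :
    ∏ i : Fin m, c (evenIdx i) * c (oddIdx i) = ∏ a, c a := by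
  rw [← Equiv.prod_comp (pairIdx m), Fintype.prod_prod_type]
  exact Finset.prod_congr rfl fun i _ => by simp [mul_comm]

theorem pfaffianTerm_conj {ι : Type*} [Fintype ι] (M : Matrix ι ι R)
    (X : Matrix ι (Fin (2 * m)) R) (σ : Equiv.Perm (Fin (2 * m))) :
    pfaffianTerm (Xᵀ * M * X) σ = ∑ f : Fin (2 * m) → ι,
      (∏ i, M (f (evenIdx i)) (f (oddIdx i))) * ((Equiv.Perm.sign σ : ℤ) * ∏ a, X (f a) (σ a)) := by
  classical
  simp only [pfaffianTerm, transpose_mul_mul_apply, Fintype.prod_sum, Finset.mul_sum]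
  refine (Fintype.sum_equiv (pairsEquiv m ι).symm _ _ fun f => ?_).symm
  rw [← prod_pairs_eq_prod, mul_left_comm, ← Finset.prod_mul_distrib]
  rfl

theorem sum_mul_det_submatrix {n : Type*} [Fintype n] [DecidableEq n] (c : (n → n) → R)
    (X : Matrix n n R) :
    ∑ f : n → n, c f * (X.submatrix f id).det =
      X.det * ∑ τ : Equiv.Perm n, (Equiv.Perm.sign τ : ℤ) * c τ := by
  rw [Finset.mul_sum]
  refine (Finset.sum_of_injOn (fun τ : Equiv.Perm n => (τ : n → n))
    (DFunLike.coe_injective.injOn) (by simp) (fun f _ hf => ?_) fun τ _ => ?_).symm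
  · have hinj : ¬ Function.Injective f := fun h =>
      hf ⟨Equiv.ofBijective f (Finite.injective_iff_bijective.1 h), by simp, rfl⟩
    obtain ⟨a, b, hab, hne⟩ := Function.not_injective_iff.1 hinj
    rw [Matrix.det_zero_of_row_eq hne (by ext; simp [hab]), mul_zero]
  · rw [Matrix.det_permute]
    ring

theorem sum_pfaffianTerm_conj_eq_det_mul (M X : Matrix (Fin (2 * m)) (Fin (2 * m)) R) :
    ∑ σ, pfaffianTerm (Xᵀ * M * X) σ = X.det * ∑ σ, pfaffianTerm M σ := by
  have hdet (f : Fin (2 * m) → Fin (2 * m)) :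
      ∑ σ : Equiv.Perm (Fin (2 * m)), (Equiv.Perm.sign σ : ℤ) * ∏ a, X (f a) (σ a) =
        (X.submatrix f id).det := by
    rw [← Matrix.det_transpose, Matrix.det_apply']
    rfl
  simp only [pfaffianTerm_conj]
  rw [Finset.sum_comm]
  simp only [← Finset.mul_sum, hdet]
  rw [sum_mul_det_submatrix]
  rfl

theorem IsAlternating.pfaffian_conj_of_charZero [IsDomain R] [CharZero R]
    {M : Matrix (Fin (2 * m)) (Fin (2 * m)) R} (hM : IsAlternating M)
    (X : Matrix (Fin (2 * m)) (Fin (2 * m)) R) :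
    pfaffian (Xᵀ * M * X) = X.det * pfaffian M := by
  have h := sum_pfaffianTerm_conj_eq_det_mul M X
  rw [sum_pfaffianTerm M hM.apply_swap, sum_pfaffianTerm _ (hM.conj X).apply_swap,
    mul_left_comm] at h
  exact mul_left_cancel₀ (Nat.cast_ne_zero.2 Fintype.card_ne_zero) h

/-- The numbering of the basis of `R^{2m}` in which the `i`-th pair of positions is the `i`-th
hyperbolic pair of `formMatrix m R`. -/
def hyperbolicIdx (m : ℕ) : Fin (2 * m) ≃ Fin m ⊕ Fin m :=
  (pairIdx m).symm.trans ((Equiv.prodComm _ _).trans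
    ((Equiv.boolProdEquivSum (Fin m)).trans ((Equiv.refl _).sumCongr Fin.revPerm)))

theorem hyperbolicIdx_evenIdx (i : Fin m) : hyperbolicIdx m (evenIdx i) = .inl i := by
  rw [hyperbolicIdx, ← pairIdx_false, Equiv.trans_apply, Equiv.symm_apply_apply]
  rfl

theorem hyperbolicIdx_oddIdx (i : Fin m) : hyperbolicIdx m (oddIdx i) = .inr i.rev := by
  rw [hyperbolicIdx, ← pairIdx_true, Equiv.trans_apply, Equiv.symm_apply_apply]
  rfl

theorem isPfaffianPerm_one : IsPfaffianPerm (1 : Equiv.Perm (Fin (2 * m))) :=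
  ⟨fun _ _ hij => Fin.lt_def.2 (Nat.mul_lt_mul_of_pos_left hij two_pos),
    fun _ => Fin.lt_def.2 (Nat.lt_succ_self _)⟩

theorem IsPfaffianPerm.eq_one {σ : Equiv.Perm (Fin (2 * m))} (hσ : IsPfaffianPerm σ)
    {τ : Fin m → Fin m} (he : ∀ i, σ (evenIdx i) = evenIdx (τ i))
    (ho : ∀ i, σ (oddIdx i) = oddIdx (τ i)) : σ = 1 := by
  have hτ : StrictMono τ := fun i j hij => by
    have h : σ (evenIdx i) < σ (evenIdx j) := hσ.1 hij
    rw [he, he, Fin.lt_def] at h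
    exact Fin.lt_def.2 (Nat.lt_of_mul_lt_mul_left h)
  obtain rfl : τ = id := (hτ.range_inj strictMono_id).1 (by
    rw [Set.range_id, (Finite.injective_iff_surjective.1 hτ.injective).range_eq])
  ext1 a
  obtain ⟨⟨i, _ | _⟩, rfl⟩ := (pairIdx m).surjective a
  exacts [he i, ho i]

theorem exists_eq_evenIdx_and_eq_oddIdx {a b : Fin (2 * m)} (hab : a < b)
    (h : formMatrix m R (hyperbolicIdx m a) (hyperbolicIdx m b) ≠ 0) :
    ∃ j, a = evenIdx j ∧ b = oddIdx j := by
  obtain ⟨⟨i, _ | _⟩, rfl⟩ := (pairIdx m).surjective a <;>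
    obtain ⟨⟨j, _ | _⟩, rfl⟩ := (pairIdx m).surjective b <;>
    simp only [pairIdx_true, pairIdx_false, hyperbolicIdx_evenIdx, hyperbolicIdx_oddIdx, formMatrix,
      antidiagonalMatrix, fromBlocks_apply₁₁, fromBlocks_apply₁₂, fromBlocks_apply₂₁,
      fromBlocks_apply₂₂, Matrix.neg_apply, Matrix.of_apply, Matrix.zero_apply, ne_eq,
      not_true_eq_false, neg_eq_zero, ite_eq_right_iff, Fin.rev_rev, Fin.rev_inj,
      Classical.not_imp] at h hab ⊢
  · exact ⟨i, rfl, by rw [h.1]⟩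
  · rw [h.1] at hab
    simp [evenIdx, oddIdx, Fin.lt_def] at hab

theorem pfaffian_formMatrix (m : ℕ) (R : Type*) [CommRing R] :
    pfaffian ((formMatrix m R).submatrix (hyperbolicIdx m) (hyperbolicIdx m)) = 1 := by
  classical
  rw [pfaffian, Finset.sum_eq_single 1]
  · simp [hyperbolicIdx_evenIdx, hyperbolicIdx_oddIdx, formMatrix, antidiagonalMatrix]
  · intro σ hσ hne
    replace hσ : IsPfaffianPerm σ := by simpa using hσ
    by_contra h0
    have hentry (i : Fin m) : formMatrix m R (hyperbolicIdx m (σ (evenIdx i)))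
        (hyperbolicIdx m (σ (oddIdx i))) ≠ 0 := fun hi =>
      h0 (by rw [Finset.prod_eq_zero (Finset.mem_univ i) hi, mul_zero])
    choose τ he ho using fun i => exists_eq_evenIdx_and_eq_oddIdx (hσ.2 i) (hentry i)
    exact hne (hσ.eq_one he ho)
  · exact fun h => absurd (Finset.mem_filter.2 ⟨Finset.mem_univ _, isPfaffianPerm_one⟩) h

theorem det_formMatrix (m : ℕ) (R : Type*) [CommRing R] : (formMatrix m R).det = 1 := by
  have h : formMatrix m R =
      fromBlocks (antidiagonalMatrix m R) 0 0 (antidiagonalMatrix m R) *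
        (fromBlocks 1 1 0 1 * fromBlocks 1 0 (-1) 1 * fromBlocks 1 1 0 1) := by
    simp [formMatrix, Matrix.fromBlocks_multiply]
  rw [h, Matrix.det_mul, Matrix.det_mul, Matrix.det_mul, Matrix.det_fromBlocks_zero₂₁,
    Matrix.det_fromBlocks_zero₂₁, Matrix.det_fromBlocks_zero₁₂, ← Matrix.det_mul,
    antidiagonalMatrix_mul_self]
  simp

theorem IsAlternating.pfaffian_sq_of_charZero {F : Type*} [Field F] [CharZero F]
    {A : Matrix (Fin (2 * m)) (Fin (2 * m)) F} (hA : IsAlternating A) :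
    pfaffian A ^ 2 = A.det := by
  obtain ⟨X, hX⟩ := hA.exists_conj_formMatrix_eq (m := m) (by simp)
  let C := X.submatrix (hyperbolicIdx m) id
  have hC : Cᵀ * (formMatrix m F).submatrix (hyperbolicIdx m) (hyperbolicIdx m) * C = A := by
    rw [← hX, Matrix.transpose_submatrix, Matrix.submatrix_mul_equiv, Matrix.submatrix_mul_equiv,
      Matrix.submatrix_id_id]
  rw [← hC, ((isAlternating_formMatrix m F).submatrix _).pfaffian_conj_of_charZero,
    pfaffian_formMatrix, Matrix.det_mul, Matrix.det_mul, Matrix.det_transpose,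
    Matrix.det_submatrix_equiv_self, det_formMatrix]
  ring

theorem IsAlternating.pfaffian_sq {A : Matrix (Fin (2 * m)) (Fin (2 * m)) R}
    (hA : IsAlternating A) : pfaffian A ^ 2 = A.det := by
  obtain ⟨f, rfl⟩ := hA.exists_map_genericAlternating
  let P := AltRing (2 * m) ℤ
  let K := FractionRing P
  have hK : Function.Injective (algebraMap P K) := IsFractionRing.injective P K
  have : CharZero K := charZero_of_injective_algebraMap hK
  have hgeneric : pfaffian (genericAlternating (2 * m) ℤ) ^ 2 =
      (genericAlternating (2 * m) ℤ).det := hK (by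
    rw [map_pow, map_pfaffian, RingHom.map_det, RingHom.mapMatrix_apply]
    exact ((isAlternating_genericAlternating _ ℤ).map _).pfaffian_sq_of_charZero)
  rw [← map_pfaffian, ← map_pow, hgeneric, RingHom.map_det, RingHom.mapMatrix_apply]

theorem IsAlternating.isUnit_det_iff {A : Matrix (Fin (2 * m)) (Fin (2 * m)) R}
    (hA : IsAlternating A) : IsUnit A.det ↔ IsUnit (pfaffian A) := by
  rw [← hA.pfaffian_sq, isUnit_pow_iff two_ne_zero]

end pfaffian

/-! ### Schur complements -/

section schur

theorem exists_orderEmbedding_comp {ι κ : Type*} [LinearOrder ι] [Fintype κ] {w : κ → ι}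
    (hw : Function.Injective w) {N : ℕ} (hN : Fintype.card κ = N) :
    ∃ (e : Fin N ↪o ι) (φ : Fin N ≃ κ), w ∘ φ = e := by
  let e := (Finset.univ.map ⟨w, hw⟩).orderEmbOfFin (k := N) (by simpa using hN)
  have he : Set.range e = Set.range w := by
    rw [Finset.range_orderEmbOfFin]
    simp
  refine ⟨e, ((Equiv.ofInjective _ e.injective).trans (Equiv.setCongr he)).trans
    (Equiv.ofInjective _ hw).symm, ?_⟩
  funext a
  exact Equiv.apply_ofInjective_symm hw _

variable {R S ι κ : Type*} [CommRing R] [CommRing S] [Fintype κ] [DecidableEq κ]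

/-- The Schur complement of the block of `A` on the rows and columns `e`, as a matrix indexed by all
rows and columns of `A`; it vanishes in the rows and columns `e`. -/
def schurComplement (A : Matrix ι ι R) (e : κ → ι) : Matrix ι ι R :=
  A - A.submatrix id e * (A.submatrix e e)⁻¹ * A.submatrix e id

theorem map_schurComplement (f : R →+* S) {A : Matrix ι ι R} {e : κ → ι}
    (h : IsUnit (A.submatrix e e).det) :
    (schurComplement A e).map f = schurComplement (A.map f) e := by
  rw [schurComplement, schurComplement, Matrix.map_sub _ (map_sub f), Matrix.map_mul,
    Matrix.map_mul, map_inv_of_isUnit_det f h]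
  rfl

theorem schurComplement_submatrix {A : Matrix ι ι R} {e : κ → ι}
    (h : IsUnit (A.submatrix e e).det) : (schurComplement A e).submatrix e id = 0 := by
  calc (schurComplement A e).submatrix e id
      = A.submatrix e id - A.submatrix e e * (A.submatrix e e)⁻¹ * A.submatrix e id := rfl
    _ = 0 := by rw [Matrix.mul_nonsing_inv _ h, Matrix.one_mul, sub_self]

theorem isAlternating_schurComplement {A : Matrix ι ι R} (hA : IsAlternating A) {e : κ → ι}
    (h : IsUnit (A.submatrix e e).det) : IsAlternating (schurComplement A e) := by
  have hcol : A.submatrix id e = -(A.submatrix e id)ᵀ := by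
    rw [hA.transpose_submatrix, neg_neg]
  rw [schurComplement, hcol, Matrix.neg_mul, Matrix.neg_mul]
  exact hA.sub (((hA.submatrix e).inv h).conj _).neg

namespace IsAlternating

theorem det_submatrix_sumElim {A : Matrix ι ι R} (hA : IsAlternating A) {e : κ → ι}
    (h : IsUnit (A.submatrix e e).det) (i j : ι) :
    (A.submatrix (Sum.elim e ![i, j]) (Sum.elim e ![i, j])).det =
      (A.submatrix e e).det * schurComplement A e i j ^ 2 := by
  have hS := isAlternating_schurComplement hA h
  have hblocks : A.submatrix (Sum.elim e ![i, j]) (Sum.elim e ![i, j]) =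
      fromBlocks (A.submatrix e e) (A.submatrix e ![i, j]) (A.submatrix ![i, j] e)
        (A.submatrix ![i, j] ![i, j]) := by
    ext (a | a) (b | b) <;> rfl
  let _ := (A.submatrix e e).invertibleOfIsUnitDet h
  have hcompl : A.submatrix ![i, j] ![i, j] - A.submatrix ![i, j] e * ⅟(A.submatrix e e) *
      A.submatrix e ![i, j] =
        (schurComplement A e).submatrix ![i, j] ![i, j] := by
    rw [Matrix.invOf_eq_nonsing_inv]
    rfl
  rw [hblocks, Matrix.det_fromBlocks₁₁, hcompl, Matrix.det_fin_two]
  simp only [Matrix.submatrix_apply, Matrix.cons_val_zero, Matrix.cons_val_one, hS.apply_self,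
    hS.apply_swap j i]
  ring

theorem exists_isDomain_map_eq [Nontrivial R] {n : ℕ} {A : Matrix (Fin n) (Fin n) R}
    (hA : IsAlternating A) {e : κ → Fin n} (h : IsUnit (A.submatrix e e).det) :
    ∃ (L : Type) (_ : CommRing L) (_ : IsDomain L) (A' : Matrix (Fin n) (Fin n) L) (f : L →+* R),
      IsAlternating A' ∧ IsUnit (A'.submatrix e e).det ∧ A'.map f = A := by
  obtain ⟨f, rfl⟩ := hA.exists_map_genericAlternating
  let d := ((genericAlternating n ℤ).submatrix e e).det
  have hd : IsUnit (f d) := by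
    rw [RingHom.map_det]
    exact h
  have hd0 : d ≠ 0 := by
    rintro h0
    rw [h0, map_zero] at hd
    exact not_isUnit_zero hd
  let g := algebraMap (AltRing n ℤ) (Localization.Away d)
  refine ⟨Localization.Away d, inferInstance, IsLocalization.isDomain_localization
      (powers_le_nonZeroDivisors_of_noZeroDivisors hd0), (genericAlternating n ℤ).map g,
    IsLocalization.Away.lift d hd, (isAlternating_genericAlternating n ℤ).map g, ?_, ?_⟩
  · rw [Matrix.submatrix_map, ← RingHom.mapMatrix_apply, ← RingHom.map_det]
    exact IsLocalization.Away.algebraMap_isUnit d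
  · ext i j
    exact IsLocalization.Away.lift_eq d hd _

/-- Both sides have the same square, which decides the matter over a domain; the general case
follows by specialization. -/
theorem pfaffian_eq_or_eq_neg {n r : ℕ} {A : Matrix (Fin n) (Fin n) R} (hA : IsAlternating A)
    {e : Fin (2 * r) → Fin n} (h : IsUnit (A.submatrix e e).det) {i j : Fin n}
    {e' : Fin (2 * (r + 1)) → Fin n} {φ : Fin (2 * (r + 1)) ≃ Fin (2 * r) ⊕ Fin 2}
    (hφ : Sum.elim e ![i, j] ∘ φ = e') :
    pfaffian (A.submatrix e' e') =
        pfaffian (A.submatrix e e) * schurComplement A e i j ∨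
      pfaffian (A.submatrix e' e') =
        -(pfaffian (A.submatrix e e) * schurComplement A e i j) := by
  nontriviality R
  obtain ⟨L, _, _, B, f, hB, hdet, rfl⟩ := hA.exists_isDomain_map_eq h
  have hsq : pfaffian (B.submatrix e' e') ^ 2 =
      (pfaffian (B.submatrix e e) * schurComplement B e i j) ^ 2 := by
    rw [mul_pow, (hB.submatrix e).pfaffian_sq, (hB.submatrix e').pfaffian_sq, ← hφ,
      ← Matrix.submatrix_submatrix, Matrix.det_submatrix_equiv_self, hB.det_submatrix_sumElim hdet]
  rw [← map_schurComplement f hdet, Matrix.map_apply, Matrix.submatrix_map, Matrix.submatrix_map,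
    ← map_pfaffian, ← map_pfaffian, ← map_mul, ← map_neg]
  exact (sq_eq_sq_iff_eq_or_eq_neg.1 hsq).imp (congrArg f) (congrArg f)

theorem schurComplement_eq_zero {n r : ℕ} {A : Matrix (Fin n) (Fin n) R}
    (hA : IsAlternating A) {e : Fin (2 * r) ↪o Fin n} (hu : IsUnit (pfaffian (A.submatrix e e)))
    (h0 : ∀ e' : Fin (2 * (r + 1)) ↪o Fin n, pfaffian (A.submatrix e' e') = 0) :
    schurComplement A e = 0 := by
  have hd : IsUnit (A.submatrix e e).det := (hA.submatrix e).isUnit_det_iff.2 hu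
  have hS := isAlternating_schurComplement hA hd
  have hrow (a : Fin (2 * r)) (j : Fin n) : schurComplement A e (e a) j = 0 :=
    congrFun (congrFun (schurComplement_submatrix hd) a) j
  ext i j
  by_cases hi : i ∈ Set.range e
  · obtain ⟨a, rfl⟩ := hi
    exact hrow a j
  by_cases hj : j ∈ Set.range e
  · obtain ⟨a, rfl⟩ := hj
    rw [hS.apply_swap, hrow, neg_zero, Matrix.zero_apply]
  rcases eq_or_ne i j with rfl | hij
  · exact hS.apply_self i
  have hpair : Function.Injective ![i, j] := by
    simpa [Function.Injective, Fin.forall_fin_two, eq_comm] using hij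
  have hdisj : ∀ a b, e a ≠ ![i, j] b := fun a b h => by
    fin_cases b
    exacts [hi ⟨a, h⟩, hj ⟨a, h⟩]
  obtain ⟨e', φ, hφ⟩ := exists_orderEmbedding_comp (N := 2 * (r + 1))
    (e.injective.sumElim hpair hdisj) (by simp [mul_add])
  rw [Matrix.zero_apply, ← hu.mul_right_eq_zero]
  rcases hA.pfaffian_eq_or_eq_neg hd hφ with h | h
  · rw [← h, h0]
  · rw [← neg_eq_zero, ← h, h0]

theorem eq_mul_inv_mul {n r : ℕ} {A : Matrix (Fin n) (Fin n) R}
    (hA : IsAlternating A) {e : Fin (2 * r) ↪o Fin n} (hu : IsUnit (pfaffian (A.submatrix e e)))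
    (h0 : ∀ e' : Fin (2 * (r + 1)) ↪o Fin n, pfaffian (A.submatrix e' e') = 0) :
    A.submatrix id e * (A.submatrix e e)⁻¹ * A.submatrix e id = A :=
  (sub_eq_zero.1 (hA.schurComplement_eq_zero hu h0)).symm

end IsAlternating

end schur

/-! ### Rank -/

section rank

variable {F : Type*} [Field F]

theorem exists_eq_mul_submatrix {ι κ : Type*} [Finite ι] [Fintype κ] {d : ℕ} {A : Matrix ι κ F}
    (hd : A.rank = d) :
    ∃ c : Fin d → ι, Function.Injective c ∧ ∃ L : Matrix ι (Fin d) F, A = L * A.submatrix c id := by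
  obtain rfl : Module.finrank F (Submodule.span F (Set.range A.row)) = d := by
    rw [← Matrix.rank_eq_finrank_span_row, hd]
  obtain ⟨f, hf, hspan, hli⟩ := Submodule.exists_fun_fin_finrank_span_eq F (Set.range A.row)
  choose c hc using hf
  have hmem (i : ι) : A.row i ∈ Submodule.span F (Set.range f) := by
    rw [hspan]
    exact Submodule.subset_span ⟨i, rfl⟩
  choose L hL using fun i => (Submodule.mem_span_range_iff_exists_fun F).1 (hmem i)
  refine ⟨c, fun i j h => hli.injective (by rw [← hc, ← hc, h]), L, ?_⟩
  ext i j
  rw [← Matrix.row_apply (A := A), ← hL i, Finset.sum_apply]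
  simp only [← hc]
  rfl

namespace IsAlternating

variable {n : ℕ} {A : Matrix (Fin n) (Fin n) F}

theorem exists_isUnit_det {d : ℕ} (hA : IsAlternating A) (hd : A.rank = d) :
    ∃ e : Fin d ↪o Fin n, IsUnit (A.submatrix e e).det := by
  obtain ⟨c, hc, L, hL⟩ := exists_eq_mul_submatrix hd
  obtain ⟨e, φ, he⟩ := exists_orderEmbedding_comp hc (Fintype.card_fin d)
  have hrow : A.submatrix c id = A.submatrix c c * Lᵀ := by
    have hcol : A.submatrix id c = L * A.submatrix c c := congrArg (·.submatrix id c) hL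
    rw [← neg_neg (A.submatrix c id), ← hA.transpose_submatrix, hcol, Matrix.transpose_mul,
      hA.transpose_submatrix, Matrix.neg_mul, neg_neg]
  have hle : d ≤ (A.submatrix c c).rank := by
    calc d = (L * (A.submatrix c c * Lᵀ)).rank := by rw [← hrow, ← hL, hd]
      _ ≤ (A.submatrix c c * Lᵀ).rank := Matrix.rank_mul_le_right _ _
      _ ≤ (A.submatrix c c).rank := Matrix.rank_mul_le_left _ _
  refine ⟨e, ?_⟩
  rw [← he, ← Matrix.submatrix_submatrix, Matrix.det_submatrix_equiv_self,
    ← Matrix.isUnit_iff_isUnit_det, ← Matrix.mulVec_surjective_iff_isUnit]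
  refine LinearMap.range_eq_top.1 (Submodule.eq_top_of_finrank_eq
    (S := LinearMap.range (A.submatrix c c).mulVecLin) (le_antisymm ?_ ?_))
  · exact Submodule.finrank_le _
  · rwa [Module.finrank_fin_fun]

theorem rank_eq_iff {r : ℕ} (hA : IsAlternating A) : A.rank = 2 * r ↔
    (∀ e : Fin (2 * (r + 1)) ↪o Fin n, pfaffian (A.submatrix e e) = 0) ∧
      ∃ e : Fin (2 * r) ↪o Fin n, pfaffian (A.submatrix e e) ≠ 0 := by
  have hle {m : ℕ} {e : Fin (2 * m) ↪o Fin n} (he : pfaffian (A.submatrix e e) ≠ 0) :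
      2 * m ≤ A.rank := by
    have hdet : IsUnit (A.submatrix e e).det := (hA.submatrix e).isUnit_det_iff.2 he.isUnit
    simpa [Matrix.rank_of_isUnit _ ((Matrix.isUnit_iff_isUnit_det _).2 hdet)]
      using Matrix.rank_submatrix_le A e e
  constructor
  · intro h
    refine ⟨fun e => ?_, ?_⟩
    · by_contra h0
      have := hle h0
      omega
    · obtain ⟨e, he⟩ := hA.exists_isUnit_det h
      exact ⟨e, ((hA.submatrix e).isUnit_det_iff.1 he).ne_zero⟩
  · rintro ⟨h0, e, he⟩
    refine le_antisymm ?_ (hle he)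
    rw [← hA.eq_mul_inv_mul he.isUnit h0]
    exact (Matrix.rank_mul_le_right _ _).trans ((Matrix.rank_le_card_height _).trans (by simp))

end IsAlternating

end rank

/-! ### Maps with the same pulled back form -/

section torsor

variable {R ι κ ε : Type*} [CommRing R] [Fintype κ] [Fintype ε] [DecidableEq ε]
  {J : Matrix κ κ R} {e : ε → ι}

theorem IsAlternating.conj_mul_inv_mul {A : Matrix ι ι R} (hA : IsAlternating A)
    (hu : IsUnit (A.submatrix e e).det)
    (hAe : A.submatrix id e * (A.submatrix e e)⁻¹ * A.submatrix e id = A)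
    {Z : Matrix κ ε R} (hZ : Zᵀ * J * Z = A.submatrix e e) :
    (Z * (A.submatrix e e)⁻¹ * A.submatrix e id)ᵀ * J *
      (Z * (A.submatrix e e)⁻¹ * A.submatrix e id) = A := by
  calc (Z * (A.submatrix e e)⁻¹ * A.submatrix e id)ᵀ * J *
        (Z * (A.submatrix e e)⁻¹ * A.submatrix e id)
      = (A.submatrix e id)ᵀ * (A.submatrix e e)⁻¹ᵀ * (Zᵀ * J * Z) *
          (A.submatrix e e)⁻¹ * A.submatrix e id := by
        simp only [Matrix.transpose_mul, Matrix.mul_assoc]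
    _ = A.submatrix id e * ((A.submatrix e e)⁻¹ * A.submatrix e e) *
          (A.submatrix e e)⁻¹ * A.submatrix e id := by
        rw [hZ, hA.transpose_submatrix, (hA.submatrix e).transpose_inv hu, Matrix.neg_mul,
          Matrix.mul_neg, neg_neg, Matrix.mul_assoc (A.submatrix id e)]
    _ = A := by rw [Matrix.nonsing_inv_mul _ hu, Matrix.mul_one, hAe]

theorem submatrix_mul_inv_mul_eq_one [DecidableEq κ] {X : Matrix κ ι R} (σ : ε ≃ κ)
    (hu : IsUnit ((Xᵀ * J * X).submatrix e e).det) :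
    X.submatrix id e *
      (((Xᵀ * J * X).submatrix e e)⁻¹ * ((X.submatrix id e)ᵀ * J)) = 1 := by
  refine (Matrix.mul_eq_one_comm_of_equiv σ).1 ?_
  rw [Matrix.mul_assoc]
  exact Matrix.nonsing_inv_mul _ hu

theorem existsUnique_conj_eq_and_mul_eq {X Y : Matrix κ ι R} (σ : ε ≃ κ)
    (hXY : Xᵀ * J * X = Yᵀ * J * Y) (hu : IsUnit ((Yᵀ * J * Y).submatrix e e).det) :
    ∃! g : Matrix κ κ R, gᵀ * J * g = J ∧ g * Y = X := by
  classical
  let Xe := X.submatrix id e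
  let Ye := Y.submatrix id e
  let N := ((Yᵀ * J * Y).submatrix e e)⁻¹ * (Yeᵀ * J)
  let N' := ((Yᵀ * J * Y).submatrix e e)⁻¹ * (Xeᵀ * J)
  have hYN : Ye * N = 1 := submatrix_mul_inv_mul_eq_one σ hu
  have hXN' : Xe * N' = 1 := by
    have := submatrix_mul_inv_mul_eq_one σ (hXY ▸ hu)
    rwa [hXY] at this
  have hN : N * Y = N' * X := by
    have hrow : Xeᵀ * J * X = Yeᵀ * J * Y := congrArg (·.submatrix e id) hXY
    simp only [N, N', Matrix.mul_assoc] at hrow ⊢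
    rw [hrow]
  refine ⟨Xe * N, ⟨?_, ?_⟩, ?_⟩
  · have hblock : Xeᵀ * J * Xe = Yeᵀ * J * Ye := congrArg (·.submatrix e e) hXY
    calc (Xe * N)ᵀ * J * (Xe * N) = Nᵀ * (Xeᵀ * J * Xe) * N := by
          simp only [Matrix.transpose_mul, Matrix.mul_assoc]
      _ = (Ye * N)ᵀ * J * (Ye * N) := by
          rw [hblock]
          simp only [Matrix.transpose_mul, Matrix.mul_assoc]
      _ = J := by rw [hYN, Matrix.transpose_one, Matrix.one_mul, Matrix.mul_one]
  · rw [Matrix.mul_assoc, hN, ← Matrix.mul_assoc, hXN', Matrix.one_mul]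
  · rintro g ⟨-, hg⟩
    have hge : g * Ye = Xe := congrArg (·.submatrix id e) hg
    rw [← hge, Matrix.mul_assoc, hYN, Matrix.mul_one]

end torsor

/-! ### Lifting along square-zero extensions -/

section lifting

variable {R S ι κ ε : Type*} [CommRing R] [CommRing S] {f : R →+* S}

theorem mul_eq_zero_of_map_eq_zero [Fintype κ] (hf : RingHom.ker f ^ 2 = ⊥) {M : Matrix ι κ R}
    {N : Matrix κ ε R} (hM : M.map f = 0) (hN : N.map f = 0) : M * N = 0 := by
  ext i j
  refine Finset.sum_eq_zero fun a _ => ?_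
  rw [← Ideal.mem_bot, ← hf, sq]
  exact Ideal.mul_mem_mul (congrFun (congrFun hM i) a) (congrFun (congrFun hN a) j)

namespace IsAlternating

theorem exists_sub_transpose_eq [LinearOrder ι] {A : Matrix ι ι R} (hA : IsAlternating A)
    (h : A.map f = 0) : ∃ M : Matrix ι ι R, M.map f = 0 ∧ M - Mᵀ = A := by
  refine ⟨.of fun i j => if i < j then A i j else 0, ?_, ?_⟩ <;> ext i j
  · have hij : f (A i j) = 0 := congrFun (congrFun h i) j
    simp [apply_ite f, hij]
  · rcases lt_trichotomy i j with hij | rfl | hij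
    · simp [hij, hij.not_gt]
    · simp [hA.apply_self]
    · simp [hij, hij.not_gt, hA.apply_swap i j]

variable [Fintype κ] {J : Matrix κ κ R}

/-- One Newton step: if `X` solves the equation up to an alternating error `D = M - Mᵀ` in the
kernel, then `X * (1 + A⁻¹ * M)` solves it exactly. -/
theorem exists_conj_eq_of_map_eq [LinearOrder ι] [Fintype ι] (hf : Function.Surjective f)
    (hker : RingHom.ker f ^ 2 = ⊥) (hJ : IsAlternating J) {A : Matrix ι ι R} (hA : IsAlternating A)
    (hu : IsUnit A.det) {X₀ : Matrix κ ι S} (hX₀ : X₀ᵀ * J.map f * X₀ = A.map f) :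
    ∃ X : Matrix κ ι R, X.map f = X₀ ∧ Xᵀ * J * X = A := by
  choose X hX using fun a i => hf (X₀ a i)
  replace hX : (Matrix.of X).map f = X₀ := Matrix.ext hX
  generalize Matrix.of X = X at hX
  set P := Xᵀ * J * X with hP
  have hPalt : IsAlternating P := hJ.conj X
  have hD : (A - P).map f = 0 := by
    rw [Matrix.map_sub _ (map_sub f), hP, Matrix.map_mul, Matrix.map_mul, Matrix.transpose_map, hX,
      hX₀, sub_self]
  obtain ⟨M, hM, hMD⟩ := (hA.sub hPalt).exists_sub_transpose_eq hD
  let E := A⁻¹ * M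
  have hE : E.map f = 0 := by rw [Matrix.map_mul, hM, Matrix.mul_zero]
  have hPE : P * E = M := by
    have hDE := mul_eq_zero_of_map_eq_zero hker hD hE
    rwa [Matrix.sub_mul, sub_eq_zero, Matrix.mul_nonsing_inv_cancel_left _ _ hu, eq_comm] at hDE
  have hEP : Eᵀ * P = -Mᵀ := by
    rw [← hPE, Matrix.transpose_mul P, hPalt.transpose_eq, Matrix.mul_neg, neg_neg]
  have hEM : Eᵀ * M = 0 :=
    mul_eq_zero_of_map_eq_zero hker (by rw [Matrix.transpose_map, hE, Matrix.transpose_zero]) hM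
  refine ⟨X * (1 + E), ?_, ?_⟩
  · rw [Matrix.mul_add, Matrix.mul_one, Matrix.map_add _ (map_add f), Matrix.map_mul, hE, hX,
      Matrix.mul_zero, add_zero]
  · calc (X * (1 + E))ᵀ * J * (X * (1 + E)) = (1 + Eᵀ) * P * (1 + E) := by
          simp only [hP, Matrix.transpose_mul, Matrix.transpose_add, Matrix.transpose_one,
            Matrix.mul_assoc]
      _ = P + P * E + (Eᵀ * P + Eᵀ * (P * E)) := by noncomm_ring
      _ = P + (M - Mᵀ) := by rw [hEP, hPE, hEM]; abel
      _ = A := by rw [hMD, add_sub_cancel]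

theorem exists_conj_eq_of_map_eq_of_submatrix [LinearOrder ε] [Fintype ε]
    (hf : Function.Surjective f) (hker : RingHom.ker f ^ 2 = ⊥) (hJ : IsAlternating J)
    {A : Matrix ι ι R} (hA : IsAlternating A) {e : ε → ι} (σ : ε ≃ κ)
    (hu : IsUnit (A.submatrix e e).det)
    (hAe : A.submatrix id e * (A.submatrix e e)⁻¹ * A.submatrix e id = A)
    {X₀ : Matrix κ ι S} (hX₀ : X₀ᵀ * J.map f * X₀ = A.map f) :
    ∃ X : Matrix κ ι R, X.map f = X₀ ∧ Xᵀ * J * X = A := by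
  classical
  obtain ⟨Z, hZ, hZA⟩ := exists_conj_eq_of_map_eq hf hker hJ (hA.submatrix e) hu
    (X₀ := X₀.submatrix id e) (congrArg (·.submatrix e e) hX₀)
  refine ⟨Z * (A.submatrix e e)⁻¹ * A.submatrix e id, ?_, hA.conj_mul_inv_mul hu hAe hZA⟩
  have hu₀ : IsUnit ((X₀ᵀ * J.map f * X₀).submatrix e e).det := by
    rw [hX₀, Matrix.submatrix_map, ← RingHom.mapMatrix_apply, ← RingHom.map_det]
    exact hu.map f
  have hrow : (A.map f).submatrix e id = (X₀.submatrix id e)ᵀ * J.map f * X₀ :=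
    (congrArg (·.submatrix e id) hX₀).symm
  rw [Matrix.map_mul, Matrix.map_mul, hZ, map_inv_of_isUnit_det f hu, ← Matrix.submatrix_map,
    ← Matrix.submatrix_map, hrow, ← hX₀, Matrix.mul_assoc, ← Matrix.mul_assoc _ _ X₀,
    ← Matrix.mul_assoc _ _ X₀, submatrix_mul_inv_mul_eq_one σ hu₀, Matrix.one_mul]

end IsAlternating

end lifting

/-! ### Points of the coordinate rings -/

section points

variable {r n s : ℕ} {k : Type u} [CommRing k] {B : Type*} [CommRing B] [Algebra k B]

/-- The matrix of a `B`-point of `Hom(V, E)`. -/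
def homMatrix (x : HomRing r n k →ₐ[k] B) : Matrix (Fin r ⊕ Fin r) (Fin n) B :=
  (genericMatrix (Fin r ⊕ Fin r) (Fin n) k).map x

/-- The matrix of a `B`-point of the symplectic group. -/
def symplecticMatrix (g : SymplecticRing r k →ₐ[k] B) :
    Matrix (Fin r ⊕ Fin r) (Fin r ⊕ Fin r) B :=
  (SymplecticRing.generic r k).map g

/-- The alternating matrix of a `B`-point of the Pfaffian scheme. -/
def pfaffianMatrix (a : PfaffianRing n s k →ₐ[k] B) : Matrix (Fin n) (Fin n) B :=
  (PfaffianRing.generic n s k).map a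

theorem homMatrix_injective :
    Function.Injective (homMatrix : (HomRing r n k →ₐ[k] B) → Matrix _ _ B) :=
  fun _ _ h => HomRing.algHom_ext h

theorem exists_homMatrix_eq (X : Matrix (Fin r ⊕ Fin r) (Fin n) B) :
    ∃ x : HomRing r n k →ₐ[k] B, homMatrix x = X :=
  ⟨MvPolynomial.aeval fun p => X p.1 p.2, map_genericMatrix_aeval X⟩

theorem homMatrix_comp {C : Type*} [CommRing C] [Algebra k C] (f : B →ₐ[k] C)
    (x : HomRing r n k →ₐ[k] B) : homMatrix (f.comp x) = (homMatrix x).map f := rfl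

theorem symplecticMatrix_injective :
    Function.Injective (symplecticMatrix : (SymplecticRing r k →ₐ[k] B) → Matrix _ _ B) :=
  fun _ _ h => SymplecticRing.algHom_ext h

theorem conj_symplecticMatrix (g : SymplecticRing r k →ₐ[k] B) :
    (symplecticMatrix g)ᵀ * formMatrix r B * symplecticMatrix g = formMatrix r B :=
  SymplecticRing.map_generic_rel g

theorem exists_symplecticMatrix_eq {g : Matrix (Fin r ⊕ Fin r) (Fin r ⊕ Fin r) B}
    (hg : gᵀ * formMatrix r B * g = formMatrix r B) :
    ∃ γ : SymplecticRing r k →ₐ[k] B, symplecticMatrix γ = g :=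
  ⟨SymplecticRing.lift g hg, SymplecticRing.lift_generic g hg⟩

theorem symplecticMatrix_comp {C : Type*} [CommRing C] [Algebra k C] (f : B →ₐ[k] C)
    (g : SymplecticRing r k →ₐ[k] B) :
    symplecticMatrix (f.comp g) = (symplecticMatrix g).map f := rfl

theorem pfaffianMatrix_injective :
    Function.Injective (pfaffianMatrix : (PfaffianRing n s k →ₐ[k] B) → Matrix _ _ B) := by
  intro a b h
  refine Ideal.Quotient.algHom_ext _ (MvPolynomial.algHom_ext fun p => ?_)
  have := congrFun (congrFun h p.1.1) p.1.2
  simp only [pfaffianMatrix, PfaffianRing.generic, Matrix.map_apply, genericAlternating,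
    alternatingMatrix, Matrix.of_apply, dif_pos p.2] at this
  exact this

theorem pfaffianMatrix_comp {C : Type*} [CommRing C] [Algebra k C] (f : B →ₐ[k] C)
    (a : PfaffianRing n s k →ₐ[k] B) : pfaffianMatrix (f.comp a) = (pfaffianMatrix a).map f := rfl

theorem isAlternating_pfaffianMatrix (a : PfaffianRing n s k →ₐ[k] B) :
    IsAlternating (pfaffianMatrix a) :=
  ((isAlternating_genericAlternating n k).map (PfaffianRing.mk n s k).toRingHom).map a.toRingHom

theorem pfaffian_pfaffianMatrix (a : PfaffianRing n s k →ₐ[k] B) {m : ℕ}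
    (e : Fin (2 * m) → Fin n) :
    pfaffian ((pfaffianMatrix a).submatrix e e) =
      a (PfaffianRing.mk n s k (pfaffian ((genericAlternating n k).submatrix e e))) :=
  (map_pfaffian (a.comp (PfaffianRing.mk n s k)).toRingHom
    ((genericAlternating n k).submatrix e e)).symm

theorem pfaffian_pfaffianMatrix_eq_zero (a : PfaffianRing n s k →ₐ[k] B)
    (e : Fin (2 * s) ↪o Fin n) : pfaffian ((pfaffianMatrix a).submatrix e e) = 0 := by
  have hgen : PfaffianRing.mk n s k (pfaffian ((genericAlternating n k).submatrix e e)) = 0 :=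
    Ideal.Quotient.eq_zero_iff_mem.2 (Ideal.subset_span ⟨e, rfl⟩)
  rw [pfaffian_pfaffianMatrix, hgen, map_zero]

theorem pfaffianMatrix_comp_coquotient (h : r < s) (x : HomRing r n k →ₐ[k] B) :
    pfaffianMatrix (x.comp (coquotient r n k s h)) =
      (homMatrix x)ᵀ * formMatrix r B * homMatrix x := by
  have hgen : pfaffianMatrix (x.comp (coquotient r n k s h)) = (pulledBackForm r n k).map x := by
    rw [← map_genericAlternating_coquotientAux]
    rfl
  rw [hgen, pulledBackForm, Matrix.map_mul, Matrix.map_mul, Matrix.transpose_map, map_formMatrix]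
  rfl

theorem comp_coquotient_eq_iff (h : r < s) {x : HomRing r n k →ₐ[k] B}
    {a : PfaffianRing n s k →ₐ[k] B} : x.comp (coquotient r n k s h) = a ↔
      (homMatrix x)ᵀ * formMatrix r B * homMatrix x = pfaffianMatrix a := by
  rw [← pfaffianMatrix_comp_coquotient h, pfaffianMatrix_injective.eq_iff]

theorem existsUnique_symplecticMatrix_mul_eq (h : r < s) {x y : HomRing r n k →ₐ[k] B}
    (hxy : x.comp (coquotient r n k s h) = y.comp (coquotient r n k s h))
    {e : Fin (2 * r) → Fin n}
    (hu : IsUnit (pfaffian ((pfaffianMatrix (y.comp (coquotient r n k s h))).submatrix e e))) :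
    ∃! g : SymplecticRing r k →ₐ[k] B, symplecticMatrix g * homMatrix y = homMatrix x := by
  rw [comp_coquotient_eq_iff, pfaffianMatrix_comp_coquotient] at hxy
  replace hu := ((isAlternating_pfaffianMatrix _).submatrix e).isUnit_det_iff.2 hu
  rw [pfaffianMatrix_comp_coquotient] at hu
  obtain ⟨g, ⟨hgJ, hg⟩, hunique⟩ :=
    existsUnique_conj_eq_and_mul_eq (hyperbolicIdx r) hxy hu
  obtain ⟨γ, rfl⟩ := exists_symplecticMatrix_eq (k := k) hgJ
  exact ⟨γ, hg, fun γ' hγ' =>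
    symplecticMatrix_injective (hunique _ ⟨conj_symplecticMatrix γ', hγ'⟩)⟩

theorem exists_comp_coquotient_eq {F : Type*} [Field F] [Algebra k F]
    (a : PfaffianRing n (r + 1) k →ₐ[k] F) {e : Fin (2 * r) ↪o Fin n}
    (he : pfaffian ((pfaffianMatrix a).submatrix e e) ≠ 0) :
    ∃ x : HomRing r n k →ₐ[k] F, x.comp (coquotient r n k (r + 1) r.lt_add_one) = a := by
  have hA := isAlternating_pfaffianMatrix a
  obtain ⟨Z, hZ⟩ := (hA.submatrix e).exists_conj_formMatrix_eq (m := r) (by simp)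
  obtain ⟨x, hx⟩ := exists_homMatrix_eq (k := k)
    (Z * ((pfaffianMatrix a).submatrix e e)⁻¹ * (pfaffianMatrix a).submatrix e id)
  refine ⟨x, (comp_coquotient_eq_iff _).2 ?_⟩
  rw [hx]
  exact hA.conj_mul_inv_mul ((hA.submatrix e).isUnit_det_iff.2 he.isUnit)
    (hA.eq_mul_inv_mul he.isUnit (pfaffian_pfaffianMatrix_eq_zero a)) hZ

theorem exists_comp_eq_and_comp_coquotient_eq {C : Type*} [CommRing C] [Algebra k C]
    {f : B →ₐ[k] C} (hf : Function.Surjective f) (hker : RingHom.ker (f : B →+* C) ^ 2 = ⊥)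
    {a : PfaffianRing n (r + 1) k →ₐ[k] B} {e : Fin (2 * r) ↪o Fin n}
    (hu : IsUnit (pfaffian ((pfaffianMatrix a).submatrix e e))) {x₀ : HomRing r n k →ₐ[k] C}
    (hx₀ : x₀.comp (coquotient r n k (r + 1) r.lt_add_one) = f.comp a) :
    ∃ x : HomRing r n k →ₐ[k] B,
      f.comp x = x₀ ∧ x.comp (coquotient r n k (r + 1) r.lt_add_one) = a := by
  have hA := isAlternating_pfaffianMatrix a
  rw [comp_coquotient_eq_iff, pfaffianMatrix_comp, ← map_formMatrix r (f : B →+* C)] at hx₀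
  obtain ⟨X, hX, hXA⟩ := (isAlternating_formMatrix r B).exists_conj_eq_of_map_eq_of_submatrix
    (f := (f : B →+* C)) hf hker hA (hyperbolicIdx r) ((hA.submatrix e).isUnit_det_iff.2 hu)
    (hA.eq_mul_inv_mul hu (pfaffian_pfaffianMatrix_eq_zero a)) hx₀
  obtain ⟨x, rfl⟩ := exists_homMatrix_eq (k := k) X
  exact ⟨x, homMatrix_injective hX, (comp_coquotient_eq_iff _).2 hXA⟩

end points

/-! ### Smoothness and flatness -/

section smooth

theorem formallySmooth_away_of_surjective_comp {R : Type u} {A : Type v} [CommRing R] [CommRing A]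
    [Algebra R A] (g : R)
    (h : ∀ ⦃B : Type max u v⦄ [CommRing B] [Algebra R B] (I : Ideal B), I ^ 2 = ⊥ →
      IsUnit (algebraMap R B g) →
        Function.Surjective ((Ideal.Quotient.mkₐ R I).comp : (A →ₐ[R] B) → A →ₐ[R] B ⧸ I)) :
    Algebra.FormallySmooth R (Localization.Away (algebraMap R A g)) := by
  refine .of_comp_surjective fun B _ _ I hI φ => ?_
  have hloc : IsUnit (algebraMap R (Localization.Away (algebraMap R A g)) g) := by
    rw [IsScalarTower.algebraMap_apply R A (Localization.Away _)]
    exact IsLocalization.Away.algebraMap_isUnit _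
  have hg : IsUnit (algebraMap R B g) := by
    rw [← IsNilpotent.isUnit_quotient_mk_iff ⟨2, hI⟩]
    exact φ.commutes g ▸ hloc.map φ
  obtain ⟨x, hx⟩ := h I hI hg (φ.comp (IsScalarTower.toAlgHom R A _))
  let ψ : Localization.Away (algebraMap R A g) →ₐ[R] B :=
    IsLocalization.liftAlgHom (M := .powers (algebraMap R A g)) (f := x) (by
      rintro ⟨_, m, rfl⟩
      simpa using hg.pow m)
  refine ⟨ψ, IsLocalization.algHom_ext (.powers (algebraMap R A g)) ?_⟩
  rw [AlgHom.comp_assoc]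
  exact (congrArg _ (AlgHom.ext fun z => IsLocalization.lift_eq _ z)).trans hx

theorem smooth_away_of_exists_comp_eq {k P H : Type u} [CommRing k] [CommRing P] [CommRing H]
    [Algebra k P] [Algebra k H] [Algebra.FiniteType k P] [Algebra.FinitePresentation k H]
    (f : P →ₐ[k] H) (g : P)
    (h : ∀ ⦃B : Type u⦄ [CommRing B] [Algebra k B] (I : Ideal B), I ^ 2 = ⊥ →
      ∀ (a : P →ₐ[k] B) (x₀ : H →ₐ[k] B ⧸ I), IsUnit (a g) →
        x₀.comp f = (Ideal.Quotient.mkₐ k I).comp a →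
          ∃ x : H →ₐ[k] B, (Ideal.Quotient.mkₐ k I).comp x = x₀ ∧ x.comp f = a) :
    ((algebraMap H (Localization.Away (f g))).comp f.toRingHom).Smooth := by
  let _ : Algebra P H := f.toRingHom.toAlgebra
  change (algebraMap P (Localization.Away (algebraMap P H g))).Smooth
  rw [RingHom.smooth_algebraMap]
  have : Algebra.FinitePresentation H (Localization.Away (algebraMap P H g)) :=
    IsLocalization.Away.finitePresentation (algebraMap P H g)
  have : Algebra.FinitePresentation k (Localization.Away (algebraMap P H g)) :=
    .trans k H (Localization.Away (algebraMap P H g))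
  refine ⟨formallySmooth_away_of_surjective_comp g fun B _ _ I hI hg x₀ => ?_,
    .of_restrict_scalars_finitePresentation k P _⟩
  let _ : Algebra k B := ((algebraMap P B).comp (algebraMap k P)).toAlgebra
  have : IsScalarTower k P B := .of_algebraMap_eq fun _ => rfl
  obtain ⟨x, hx, hxa⟩ := h I hI (IsScalarTower.toAlgHom k P B) (x₀.restrictScalars k) hg
    (AlgHom.ext x₀.commutes)
  exact ⟨{ x with commutes' := DFunLike.congr_fun hxa },
    AlgHom.ext fun z => DFunLike.congr_fun hx z⟩

theorem flat_localRingHom_of_flat_away {R S : Type*} [CommRing R] [CommRing S] (φ : R →+* S)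
    {g : S} {q : Ideal S} [q.IsPrime] (hg : g ∉ q)
    (h : ((algebraMap S (Localization.Away g)).comp φ).Flat) :
    (Localization.localRingHom (q.comap φ) q φ rfl).Flat := by
  let p := q.comap φ
  let Sg := Localization.Away g
  algebraize [φ]
  have hle : Submonoid.powers g ≤ q.primeCompl := Submonoid.powers_le.2 hg
  let f : Sg →ₐ[S] Localization.AtPrime q := IsLocalization.liftAlgHom
    (M := Submonoid.powers g) (f := Algebra.ofId _ _)
    fun x => IsLocalization.map_units (M := q.primeCompl) _ ⟨x.1, hle x.2⟩
  algebraize [f.toRingHom, Localization.localRingHom p q φ rfl]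
  have : IsScalarTower R Sg (Localization.AtPrime q) := .to₁₃₄ _ S _ _
  have : IsLocalization (Algebra.algebraMapSubmonoid Sg q.primeCompl) (Localization.AtPrime q) :=
    .isLocalization_of_submonoid_le _ _ (Submonoid.powers g) _ hle
  have : Module.Flat Sg (Localization.AtPrime q) :=
    IsLocalization.flat _ (Algebra.algebraMapSubmonoid Sg q.primeCompl)
  have : Module.Flat R Sg := RingHom.flat_algebraMap_iff.1 h
  have : IsScalarTower R (Localization.AtPrime p) (Localization.AtPrime q) :=
    .of_algebraMap_eq fun x => (Localization.localRingHom_to_map _ _ _ rfl x).symm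
  exact (Module.flat_iff_of_isLocalization (Localization.AtPrime p) p.primeCompl
    (Localization.AtPrime q)).2 (.trans R Sg _)

variable {r n : ℕ} {k : Type u} [CommRing k]

instance finiteType_pfaffianRing (s : ℕ) : Algebra.FiniteType k (PfaffianRing n s k) :=
  .of_surjective (PfaffianRing.mk n s k) Ideal.Quotient.mk_surjective

theorem smooth_coquotient_away (e : Fin (2 * r) ↪o Fin n) :
    ((algebraMap (HomRing r n k) (Localization.Away (coquotient r n k (r + 1) r.lt_add_one
      (PfaffianRing.mk n (r + 1) k (pfaffian ((genericAlternating n k).submatrix e e)))))).comp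
        (coquotient r n k (r + 1) r.lt_add_one).toRingHom).Smooth := by
  refine smooth_away_of_exists_comp_eq (coquotient r n k (r + 1) r.lt_add_one) _
    fun B _ _ I hI a x₀ hu hx₀ => ?_
  have hker : RingHom.ker (Ideal.Quotient.mkₐ k I : B →+* B ⧸ I) ^ 2 = ⊥ := by
    rw [Ideal.Quotient.mkₐ_ker, hI]
  exact exists_comp_eq_and_comp_coquotient_eq Ideal.Quotient.mk_surjective hker
    ((pfaffian_pfaffianMatrix a e).symm ▸ hu) hx₀

theorem flat_localRingHom_coquotient {q : Ideal (HomRing r n k)} [q.IsPrime]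
    {e : Fin (2 * r) ↪o Fin n}
    (he : coquotient r n k (r + 1) r.lt_add_one (PfaffianRing.mk n (r + 1) k
      (pfaffian ((genericAlternating n k).submatrix e e))) ∉ q) :
    (Localization.localRingHom (q.comap (coquotient r n k (r + 1) r.lt_add_one).toRingHom) q
      (coquotient r n k (r + 1) r.lt_add_one).toRingHom rfl).Flat :=
  flat_localRingHom_of_flat_away _ he (smooth_coquotient_away e).flat

theorem exists_comap_coquotient_eq {p : PrimeSpectrum (PfaffianRing n (r + 1) k)}
    {e : Fin (2 * r) ↪o Fin n}
    (he : PfaffianRing.mk n (r + 1) k (pfaffian ((genericAlternating n k).submatrix e e)) ∉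
      p.asIdeal) :
    ∃ q, PrimeSpectrum.comap (coquotient r n k (r + 1) r.lt_add_one).toRingHom q = p := by
  obtain ⟨x, hx⟩ := exists_comp_coquotient_eq (e := e)
    (IsScalarTower.toAlgHom k (PfaffianRing n (r + 1) k) p.asIdeal.ResidueField) (by
      rw [pfaffian_pfaffianMatrix]
      exact fun h => he (Ideal.algebraMap_residueField_eq_zero.1 h))
  refine ⟨PrimeSpectrum.comap x.toRingHom ⊥, ?_⟩
  rw [← PrimeSpectrum.comap_comp_apply]
  have hx' : x.toRingHom.comp (coquotient r n k (r + 1) r.lt_add_one).toRingHom =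
      algebraMap _ p.asIdeal.ResidueField := congrArg AlgHom.toRingHom hx
  rw [hx']
  exact PrimeSpectrum.ext p.asIdeal.ker_algebraMap_residueField

end smooth

/-! ### The rank stratum -/

section stratum

variable {n r : ℕ} {k : Type u} [CommRing k]

theorem pfaffianIdeal_le_iff {I : Ideal (AltRing n k)} : pfaffianIdeal n r k ≤ I ↔
    ∀ e : Fin (2 * r) ↪o Fin n, pfaffian ((genericAlternating n k).submatrix e e) ∈ I := by
  rw [pfaffianIdeal, Ideal.span_le, Set.range_subset_iff]
  rfl

theorem rank_residueField_eq_iff (x : PrimeSpectrum (AltRing n k)) :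
    ((genericAlternating n k).map
        (algebraMap (AltRing n k) x.asIdeal.ResidueField)).rank = 2 * r ↔
      pfaffianIdeal n (r + 1) k ≤ x.asIdeal ∧ ¬ pfaffianIdeal n r k ≤ x.asIdeal := by
  have hA := (isAlternating_genericAlternating n k).map (algebraMap _ x.asIdeal.ResidueField)
  have hpf {m : ℕ} (e : Fin (2 * m) ↪o Fin n) :
      pfaffian (((genericAlternating n k).map
        (algebraMap _ x.asIdeal.ResidueField)).submatrix e e) = 0 ↔
        pfaffian ((genericAlternating n k).submatrix e e) ∈ x.asIdeal := by
    rw [Matrix.submatrix_map, ← map_pfaffian, Ideal.algebraMap_residueField_eq_zero]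
  simp only [hA.rank_eq_iff, hpf, pfaffianIdeal_le_iff, ne_eq, not_forall]

end stratum

open CategoryTheory AlgebraicGeometry MonoidalCategory CartesianMonoidalCategory Opposite
open scoped MonObj

/-! ### Functor of points of affine schemes -/

section functorOfPoints

variable {k : Type u} [CommRing k]

/-- The `k`-algebra of global functions on a `k`-scheme `T`. Homomorphisms to it from
a `k`-algebra `A` are the `T`-valued points of `Spec A`. -/
abbrev globalFunctions (T : Over (Spec (CommRingCat.of k))) : Type u :=
  ((algΓ (CommRingCat.of k)).obj T).unop

/-- The `T`-valued point of an affine `k`-scheme, as a homomorphism from its coordinate ring to the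
global functions on `T`. -/
def pointHom {T : Over (Spec (CommRingCat.of k))} {A : Type u} [CommRing A] [Algebra k A]
    (f : T ⟶ specOver k A) : A →ₐ[k] globalFunctions T :=
  (((algΓAlgSpecAdjunction (CommRingCat.of k)).homEquiv T (op (CommAlgCat.of k A))).symm f).unop.hom

theorem pointHom_bijective (T : Over (Spec (CommRingCat.of k))) (A : Type u) [CommRing A]
    [Algebra k A] :
    Function.Bijective (pointHom : (T ⟶ specOver k A) → (A →ₐ[k] globalFunctions T)) := by
  constructor
  · intro f g h
    apply ((algΓAlgSpecAdjunction (CommRingCat.of k)).homEquiv T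
      (op (CommAlgCat.of k A))).symm.injective
    apply Quiver.Hom.unop_inj
    ext1
    exact h
  · intro φ
    refine ⟨(algΓAlgSpecAdjunction (CommRingCat.of k)).homEquiv T (op (CommAlgCat.of k A))
      (CommAlgCat.ofHom φ).op, ?_⟩
    rw [pointHom, Equiv.symm_apply_apply]
    rfl

theorem pointHom_comp {T : Over (Spec (CommRingCat.of k))} {A B : Type u} [CommRing A]
    [Algebra k A] [CommRing B] [Algebra k B] (f : T ⟶ specOver k A) (φ : B →ₐ[k] A) :
    pointHom (f ≫ (algSpec (CommRingCat.of k)).map (CommAlgCat.ofHom φ).op) =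
      (pointHom f).comp φ := by
  rw [pointHom, Adjunction.homEquiv_naturality_right_symm]
  rfl

theorem isUnit_pointHom {T : Over (Spec (CommRingCat.of k))} {A : Type u} [CommRing A]
    [Algebra k A] (f : T ⟶ specOver k A) (a : A)
    (h : Set.range f.left ⊆ (PrimeSpectrum.basicOpen a : Set (PrimeSpectrum A))) :
    IsUnit (pointHom f a) := by
  let j := (algSpec (CommRingCat.of k)).map
    (CommAlgCat.ofHom (IsScalarTower.toAlgHom k A (Localization.Away a))).op
  have hj : IsOpenImmersion j.left :=
    IsOpenImmersion.of_isLocalization (R := CommRingCat.of A) (S := Localization.Away a) a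
  have hr : Set.range f.left ⊆ Set.range j.left := by
    refine h.trans_eq ?_
    exact (PrimeSpectrum.localization_away_comap_range (Localization.Away a) a).symm
  let g : T ⟶ specOver k (Localization.Away a) :=
    Over.homMk (IsOpenImmersion.lift j.left f.left hr) (by
      rw [← Over.w j, IsOpenImmersion.lift_fac_assoc]
      exact Over.w f)
  have hg : g ≫ j = f := by
    ext1
    exact IsOpenImmersion.lift_fac _ _ _
  rw [← hg, pointHom_comp]
  exact (IsLocalization.Away.algebraMap_isUnit a).map (pointHom g)

variable {r n : ℕ}

open scoped TensorProduct
open Algebra.TensorProduct (includeLeft includeRight)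

theorem exists_pointHom_lift {A M : Type u} [CommRing A] [Algebra k A] [CommRing M] [Algebra k M]
    {T : Over (Spec (CommRingCat.of k))} (g : T ⟶ specOver k A) (y : T ⟶ specOver k M) :
    ∃ z : A ⊗[k] M →ₐ[k] globalFunctions T, z.comp includeLeft = pointHom g ∧
      z.comp includeRight = pointHom y ∧ ∀ {C : Type u} [CommRing C] [Algebra k C]
        (φ : C →ₐ[k] A ⊗[k] M), pointHom (lift g y ≫
          Functor.LaxMonoidal.μ (algSpec (CommRingCat.of k)) (op (CommAlgCat.of k A))
            (op (CommAlgCat.of k M)) ≫ (algSpec (CommRingCat.of k)).map (CommAlgCat.ofHom φ).op) =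
          z.comp φ := by
  let F := algSpec (CommRingCat.of k)
  let A' : (CommAlgCat k)ᵒᵖ := op (CommAlgCat.of k A)
  let M' : (CommAlgCat k)ᵒᵖ := op (CommAlgCat.of k M)
  let z : T ⟶ specOver k (A ⊗[k] M) := lift g y ≫ Functor.LaxMonoidal.μ F A' M'
  refine ⟨pointHom z, ?_, ?_, ?_⟩
  · rw [← pointHom_comp]
    refine congrArg pointHom ?_
    change (lift g y ≫ Functor.LaxMonoidal.μ F A' M') ≫ F.map (fst A' M') = g
    rw [Category.assoc, Functor.Monoidal.μ_fst, lift_fst]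
  · rw [← pointHom_comp]
    refine congrArg pointHom ?_
    change (lift g y ≫ Functor.LaxMonoidal.μ F A' M') ≫ F.map (snd A' M') = y
    rw [Category.assoc, Functor.Monoidal.μ_snd, lift_snd]
  · intro C _ _ φ
    rw [← pointHom_comp]
    exact congrArg pointHom (Category.assoc _ _ _).symm

theorem homMatrix_pointHom_smul {T : Over (Spec (CommRingCat.of k))}
    (g : T ⟶ symplecticGroupScheme r k) (y : T ⟶ homScheme r n k) :
    homMatrix (pointHom (lift g y ≫ γ[symplecticGroupScheme r k, homScheme r n k])) =
      symplecticMatrix (pointHom g) * homMatrix (pointHom y) := by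
  obtain ⟨z, hz1, hz2, hz⟩ := exists_pointHom_lift (A := SymplecticRing r k)
    (M := HomRing r n k) g y
  have h : pointHom (lift g y ≫ γ[symplecticGroupScheme r k, homScheme r n k]) =
      z.comp (coaction r n k) := hz (coaction r n k)
  rw [← hz1, ← hz2]
  refine (congrArg homMatrix h).trans ?_
  rw [homMatrix_comp, homMatrix_comp, symplecticMatrix_comp, ← Matrix.map_mul]
  exact congrArg (fun X => X.map z) (map_coaction r n k)

end functorOfPoints

/-! ### Restriction to open subschemes of the base -/

section restriction

variable {S : Scheme.{u}}

theorem isIso_of_existsUnique_lift {X Y : Scheme.{u}} (f : X ⟶ Y) {I : Type*} (U : I → Y.Opens)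
    (hU : iSup U = ⊤)
    (h : ∀ i (T : Scheme.{u}) (t : T ⟶ (U i).toScheme), ∃! s : T ⟶ X, s ≫ f = t ≫ (U i).ι) :
    IsIso f := by
  change MorphismProperty.isomorphisms Scheme f
  rw [IsZariskiLocalAtTarget.iff_of_iSup_eq_top (P := MorphismProperty.isomorphisms Scheme) U hU]
  intro i
  obtain ⟨s, hs, -⟩ := h i _ (𝟙 _)
  rw [Category.id_comp] at hs
  let s' : (U i).toScheme ⟶ (f ⁻¹ᵁ U i).toScheme := (isPullback_morphismRestrict f (U i)).lift
    (𝟙 _) s (by rw [hs, Category.id_comp])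
  have h1 : s' ≫ (f ⁻¹ᵁ U i).ι = s := (isPullback_morphismRestrict f (U i)).lift_snd _ _ _
  have h2 : s' ≫ (f ∣_ U i) = 𝟙 _ := (isPullback_morphismRestrict f (U i)).lift_fst _ _ _
  refine ⟨s', ?_, h2⟩
  rw [← cancel_mono (f ⁻¹ᵁ U i).ι, Category.assoc, h1, Category.id_comp]
  refine (h i _ (f ∣_ U i)).unique ?_ ?_
  · rw [Category.assoc, hs]
  · exact (morphismRestrict_ι f (U i)).symm

theorem flat_morphismRestrict_SpecMap {R S : CommRingCat.{u}} (φ : R ⟶ S) (U : (Spec R).Opens)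
    (h : ∀ q : PrimeSpectrum S, PrimeSpectrum.comap φ.hom q ∈ U →
      (Localization.localRingHom (PrimeSpectrum.comap φ.hom q).asIdeal q.asIdeal φ.hom rfl).Flat) :
    Flat (Spec.map φ ∣_ U) := by
  refine Flat.of_stalkMap _ fun x => ?_
  rw [RingHom.Flat.respectsIso.arrow_mk_iso_iff (morphismRestrictStalkMap _ _ x),
    RingHom.Flat.respectsIso.arrow_mk_iso_iff (Scheme.arrowStalkMapSpecIso φ x.1)]
  exact h x.1 x.2

theorem restrictHom_ι {X Y : Over S} (f : X ⟶ Y) (U : Y.left.Opens) :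
    restrictHom f U ≫ openSubschemeι Y U = openSubschemeι X (f.left ⁻¹ᵁ U) ≫ f := by
  ext1
  exact morphismRestrict_ι f.left U

theorem restrictSMul_restrictHom {G X Y : Over S} [MonObj G] [ModObj G X]
    (f : X ⟶ Y) (hf : γ[G, X] ≫ f = snd G X ≫ f) (U : Y.left.Opens) :
    restrictSMul f hf U ≫ restrictHom f U =
      snd G (openSubscheme X (f.left ⁻¹ᵁ U)) ≫ restrictHom f U := by
  rw [← cancel_mono (openSubschemeι Y U), Category.assoc, Category.assoc, restrictHom_ι,
    ← Category.assoc, restrictSMul_ι, Category.assoc, hf, whiskerLeft_snd_assoc]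

theorem lift_restrictSMul_eq_iff {G X Y T : Over S} [MonObj G] [ModObj G X] (f : X ⟶ Y)
    (hf : γ[G, X] ≫ f = snd G X ≫ f) (U : Y.left.Opens) (g : T ⟶ G)
    (x y : T ⟶ openSubscheme X (f.left ⁻¹ᵁ U)) :
    lift g y ≫ restrictSMul f hf U = x ↔
      lift g (y ≫ openSubschemeι X _) ≫ γ[G, X] = x ≫ openSubschemeι X _ := by
  rw [← cancel_mono (openSubschemeι X _), Category.assoc, restrictSMul_ι, ← Category.assoc,
    lift_whiskerLeft]

theorem existsUnique_comp_eq_and_comp_snd_eq {C : Type*} [Category C]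
    [CartesianMonoidalCategory C] {G X Y T : C} {a : G ⊗ X ⟶ Y} {x : T ⟶ Y} {y : T ⟶ X}
    (h : ∃! g : T ⟶ G, lift g y ≫ a = x) :
    ∃! w : T ⟶ G ⊗ X, w ≫ a = x ∧ w ≫ snd G X = y := by
  obtain ⟨g, hg, hunique⟩ := h
  refine ⟨lift g y, ⟨hg, lift_snd g y⟩, ?_⟩
  rintro w ⟨hw, rfl⟩
  have hw' : lift (w ≫ fst G X) (w ≫ snd G X) = w := by rw [← comp_lift, lift_fst_snd,
    Category.comp_id]
  rw [← hunique (w ≫ fst G X) (by simpa only [hw'] using hw), hw']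

open Limits in
theorem isIso_pullback_lift_of_existsUnique {X X' Y Z : Scheme.{u}} {f : X ⟶ Y} {f' : X' ⟶ Y}
    {p : Z ⟶ X} {q : Z ⟶ X'} (hpq : p ≫ f = q ≫ f') {I : Type*} (V : I → Y.Opens)
    (hV : iSup V = ⊤)
    (h : ∀ i (T : Scheme.{u}) (x : T ⟶ X) (y : T ⟶ X'), x ≫ f = y ≫ f' →
      Set.range (y ≫ f') ⊆ V i → ∃! w : T ⟶ Z, w ≫ p = x ∧ w ≫ q = y) :
    IsIso (pullback.lift p q hpq) := by
  refine isIso_of_existsUnique_lift _ (fun i => (pullback.snd f f' ≫ f') ⁻¹ᵁ V i)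
    (by rw [← Scheme.Hom.preimage_iSup, hV, Scheme.Hom.preimage_top]) fun i T t => ?_
  have hlift (s : T ⟶ Z) (u : T ⟶ pullback f f') : s ≫ pullback.lift p q hpq = u ↔
      s ≫ p = u ≫ pullback.fst f f' ∧ s ≫ q = u ≫ pullback.snd f f' := by
    refine ⟨fun hs => by simp only [← hs, Category.assoc, pullback.lift_fst,
      pullback.lift_snd, and_self], fun hs => pullback.hom_ext ?_ ?_⟩
    · rw [Category.assoc, pullback.lift_fst, hs.1]
    · rw [Category.assoc, pullback.lift_snd, hs.2]
  simp only [hlift]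
  refine h i T _ _ (by simp only [Category.assoc, pullback.condition]) ?_
  rintro _ ⟨z, rfl⟩
  exact (t z).2

theorem isIso_pullback_lift_left_of_existsUnique {X X' Y Z : Over S} {f : X ⟶ Y} {f' : X' ⟶ Y}
    {p : Z ⟶ X} {q : Z ⟶ X'} (hpq : p ≫ f = q ≫ f') {I : Type*} (V : I → Y.left.Opens)
    (hV : iSup V = ⊤)
    (h : ∀ i (T : Over S) (x : T ⟶ X) (y : T ⟶ X'), x ≫ f = y ≫ f' →
      Set.range (y ≫ f').left ⊆ V i → ∃! w : T ⟶ Z, w ≫ p = x ∧ w ≫ q = y) :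
    IsIso (Limits.pullback.lift (f := f.left) (g := f'.left) p.left q.left
      (congrArg CommaMorphism.left hpq)) := by
  refine isIso_pullback_lift_of_existsUnique _ V hV fun i T x y hxy hy => ?_
  let y' : Over.mk (y ≫ X'.hom) ⟶ X' := Over.homMk y rfl
  let x' : Over.mk (y ≫ X'.hom) ⟶ X := Over.homMk x (by
    rw [← Over.w f, reassoc_of% hxy, Over.w f']
    rfl)
  obtain ⟨w, ⟨hwx, hwy⟩, hunique⟩ := h i _ x' y' (by ext1; exact hxy) hy
  refine ⟨w.left, ⟨congrArg CommaMorphism.left hwx, congrArg CommaMorphism.left hwy⟩, ?_⟩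
  rintro s ⟨rfl, rfl⟩
  let s' : Over.mk ((s ≫ q.left) ≫ X'.hom) ⟶ Z := Over.homMk s (by
    rw [← Over.w q, ← Category.assoc]
    rfl)
  exact congrArg CommaMorphism.left (hunique s' ⟨by ext1; rfl, by ext1; rfl⟩)

end restriction

/-! ### The restricted quotient morphism -/

section restrictedQuotient

theorem image_comap_compl_zeroLocus_map {R S : Type*} [CommRing R] [CommRing S] (f : R →+* S)
    (hf : Function.Surjective f) (I : Ideal R) :
    PrimeSpectrum.comap f '' (PrimeSpectrum.zeroLocus (I.map f : Set S))ᶜ =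
      PrimeSpectrum.zeroLocus (RingHom.ker f : Set R) \ PrimeSpectrum.zeroLocus (I : Set R) := by
  rw [Ideal.map, PrimeSpectrum.zeroLocus_span, ← PrimeSpectrum.preimage_comap_zeroLocus,
    ← Set.preimage_compl, Set.image_preimage_eq_inter_range, range_comap_of_surjective _ f hf,
    Set.inter_comm, Set.sdiff_eq]

variable (r n s : ℕ) (k : Type u) [CommRing k]

theorem image_pfaffianOpen :
    (pfaffianInclusion n (r + 1) k).left '' (pfaffianOpen r n (r + 1) k) =
      exactRankLocus n k (2 * r) := by
  refine (image_comap_compl_zeroLocus_map (PfaffianRing.mk n (r + 1) k).toRingHom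
    Ideal.Quotient.mk_surjective (pfaffianIdeal n r k)).trans ?_
  have hker : RingHom.ker (PfaffianRing.mk n (r + 1) k).toRingHom = pfaffianIdeal n (r + 1) k :=
    Ideal.mk_ker
  rw [hker]
  exact Set.ext fun x => (rank_residueField_eq_iff x).symm

variable {r n}

/-- The open subscheme of `Y_s ∖ Y_r` where the Pfaffian of the main submatrix at the indices `e`
is invertible. As `e` varies, these cover `Y_s ∖ Y_r`. -/
def pfaffianBasicOpen (e : Fin (2 * r) ↪o Fin n) :
    (openSubscheme (pfaffianScheme n s k) (pfaffianOpen r n s k)).left.Opens :=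
  (pfaffianOpen r n s k).ι ⁻¹ᵁ PrimeSpectrum.basicOpen
    (PfaffianRing.mk n s k (pfaffian ((genericAlternating n k).submatrix e e)))

variable {s k}

theorem exists_pfaffian_notMem {x : PrimeSpectrum (PfaffianRing n s k)}
    (hx : x ∈ pfaffianOpen r n s k) : ∃ e : Fin (2 * r) ↪o Fin n,
      PfaffianRing.mk n s k (pfaffian ((genericAlternating n k).submatrix e e)) ∉ x.asIdeal := by
  have hle : ¬ pfaffianIdeal n r k ≤ x.asIdeal.comap (PfaffianRing.mk n s k).toRingHom :=
    fun h => hx (Ideal.map_le_iff_le_comap.2 h)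
  simpa [pfaffianIdeal_le_iff] using hle

theorem flat_restrictedQuotient :
    Flat (restrictedQuotient r n (r + 1) r.lt_add_one k).left := by
  refine flat_morphismRestrict_SpecMap
    (CommRingCat.ofHom (coquotient r n k (r + 1) r.lt_add_one).toRingHom)
    (pfaffianOpen r n (r + 1) k) fun q hq => ?_
  obtain ⟨e, he⟩ := exists_pfaffian_notMem hq
  exact flat_localRingHom_coquotient (q := q.asIdeal) he

theorem surjective_restrictedQuotient :
    Surjective (restrictedQuotient r n (r + 1) r.lt_add_one k).left := by
  refine ⟨fun y => ?_⟩
  obtain ⟨e, he⟩ := exists_pfaffian_notMem y.2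
  obtain ⟨q, hq⟩ := exists_comap_coquotient_eq he
  have hqy : (quotientMorphism r n (r + 1) k r.lt_add_one).left q = y.1 := hq
  have hqU : (quotientMorphism r n (r + 1) k r.lt_add_one).left q ∈ pfaffianOpen r n (r + 1) k := by
    rw [hqy]
    exact y.2
  exact ⟨⟨q, hqU⟩, Subtype.ext ((morphismRestrict_base_coe _ _ _).trans hqy)⟩

theorem pointHom_comp_quotientMorphism (h : r < s) {T : Over (Spec (CommRingCat.of k))}
    (x : T ⟶ homScheme r n k) :
    pointHom (A := PfaffianRing n s k) (x ≫ quotientMorphism r n s k h) =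
      (pointHom x).comp (coquotient r n k s h) :=
  pointHom_comp x (coquotient r n k s h)

theorem lift_smul_eq_iff {T : Over (Spec (CommRingCat.of k))}
    {g : T ⟶ symplecticGroupScheme r k} {x y : T ⟶ homScheme r n k} :
    lift g y ≫ γ[symplecticGroupScheme r k, homScheme r n k] = x ↔
      symplecticMatrix (pointHom g) * homMatrix (pointHom y) = homMatrix (pointHom x) := by
  rw [← homMatrix_pointHom_smul, homMatrix_injective.eq_iff]
  exact (pointHom_bijective T (HomRing r n k)).1.eq_iff.symm

theorem existsUnique_lift_smul_eq (h : r < s) {T : Over (Spec (CommRingCat.of k))}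
    {x y : T ⟶ homScheme r n k}
    (hxy : x ≫ quotientMorphism r n s k h = y ≫ quotientMorphism r n s k h)
    {e : Fin (2 * r) ↪o Fin n}
    (he : Set.range (y ≫ quotientMorphism r n s k h).left ⊆ (PrimeSpectrum.basicOpen
      (PfaffianRing.mk n s k (pfaffian ((genericAlternating n k).submatrix e e))) :
        Set (PrimeSpectrum (PfaffianRing n s k)))) :
    ∃! g : T ⟶ symplecticGroupScheme r k,
      lift g y ≫ γ[symplecticGroupScheme r k, homScheme r n k] = x := by
  have hxy' : (pointHom x).comp (coquotient r n k s h) =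
      (pointHom y).comp (coquotient r n k s h) :=
    (pointHom_comp_quotientMorphism h x).symm.trans
      ((congrArg pointHom hxy).trans (pointHom_comp_quotientMorphism h y))
  have hu : IsUnit (pfaffian ((pfaffianMatrix
      ((pointHom y).comp (coquotient r n k s h))).submatrix e e)) := by
    rw [← pointHom_comp_quotientMorphism, pfaffian_pfaffianMatrix]
    exact isUnit_pointHom _ _ he
  simp only [lift_smul_eq_iff]
  exact (pointHom_bijective T (SymplecticRing r k)).existsUnique_iff.1
    (existsUnique_symplecticMatrix_mul_eq h hxy' hu)

theorem existsUnique_lift_restrictSMul_eq (h : r < s) {T : Over (Spec (CommRingCat.of k))}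
    {x y : T ⟶ openSubscheme (homScheme r n k)
      ((quotientMorphism r n s k h).left ⁻¹ᵁ pfaffianOpen r n s k)}
    (hxy : x ≫ restrictHom (quotientMorphism r n s k h) (pfaffianOpen r n s k) =
      y ≫ restrictHom (quotientMorphism r n s k h) (pfaffianOpen r n s k))
    {e : Fin (2 * r) ↪o Fin n}
    (he : Set.range (y ≫ restrictHom (quotientMorphism r n s k h) (pfaffianOpen r n s k)).left ⊆
      pfaffianBasicOpen s k e) :
    ∃! g : T ⟶ symplecticGroupScheme r k,
      lift g y ≫ restrictSMul (quotientMorphism r n s k h) (smul_quotientMorphism r n s k h)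
        (pfaffianOpen r n s k) = x := by
  have hι (z : T ⟶ openSubscheme (homScheme r n k) _) :
      (z ≫ openSubschemeι _ _) ≫ quotientMorphism r n s k h =
        (z ≫ restrictHom (quotientMorphism r n s k h) (pfaffianOpen r n s k)) ≫
          openSubschemeι _ _ := by
    rw [Category.assoc, Category.assoc, restrictHom_ι]
  simp only [lift_restrictSMul_eq_iff]
  refine existsUnique_lift_smul_eq h (e := e) ?_ ?_
  · rw [hι, hι, hxy]
  · rw [hι]
    rintro _ ⟨z, rfl⟩
    exact he ⟨z, rfl⟩

theorem iSup_pfaffianBasicOpen_eq_top :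
    ⨆ e : Fin (2 * r) ↪o Fin n, pfaffianBasicOpen s k e = ⊤ :=
  eq_top_iff.2 fun z _ =>
    TopologicalSpace.Opens.mem_iSup.2 (exists_pfaffian_notMem z.2)

theorem isPrincipalBundle_restrictedQuotient :
    IsPrincipalBundle (symplecticGroupScheme r k)
      (restrictedQuotient r n (r + 1) r.lt_add_one k) where
  flat := flat_restrictedQuotient
  surjective := surjective_restrictedQuotient
  invariant := restrictSMul_restrictHom (quotientMorphism r n (r + 1) k r.lt_add_one)
    (smul_quotientMorphism r n (r + 1) k r.lt_add_one) (pfaffianOpen r n (r + 1) k)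
  isIso := isIso_pullback_lift_left_of_existsUnique
    (restrictSMul_restrictHom (quotientMorphism r n (r + 1) k r.lt_add_one)
      (smul_quotientMorphism r n (r + 1) k r.lt_add_one) (pfaffianOpen r n (r + 1) k))
    (pfaffianBasicOpen (r + 1) k) iSup_pfaffianBasicOpen_eq_top
    fun _ _ _ _ hxy he => existsUnique_comp_eq_and_comp_snd_eq
      (existsUnique_lift_restrictSMul_eq r.lt_add_one hxy he)

end restrictedQuotient

end SymplecticInvariants

end

theorem mainTheorem4_general (k : Type*) [CommRing k] (r n : ℕ) :
    (pfaffianInclusion n (r + 1) k).left '' (pfaffianOpen r n (r + 1) k) =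
        exactRankLocus n k (2 * r) ∧
      IsPrincipalBundle (symplecticGroupScheme r k)
        (restrictedQuotient r n (r + 1) r.lt_add_one k) :=
  ⟨image_pfaffianOpen r n k, isPrincipalBundle_restrictedQuotient⟩

theorem mainTheorem4 (k : Type*) [Field k] [IsAlgClosed k] (t n : ℕ) (ht : 2 ≤ t)
    (hn : 2 * t ≤ n) :
    (pfaffianInclusion n t k).left '' (pfaffianOpen (t - 1) n t k) =
        exactRankLocus n k (2 * (t - 1)) ∧
      IsPrincipalBundle (symplecticGroupScheme (t - 1) k)
        (restrictedQuotient (t - 1) n t (Nat.sub_one_lt_of_lt ht) k) := by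
  obtain ⟨r, rfl⟩ : ∃ r, t = r + 1 := ⟨t - 1, by omega⟩
  exact mainTheorem4_general k r n
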